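/- **Setting.** Let $K\ge 1$, let $S\subseteq[0,\infty)$, and let $F_1,\dots,F_K$ (the arms) be Borel probability measures concentrated on $S$ that are $1$-sub-Gaussian in the sense that $F_i(|X|>u)\le 2e^{-u^2/2}$ for all $u\ge 0$. Let $h:[0,1]\to[0,1]$ with $h(0)=0$. For a probability measure with CDF $Q$, the distortion riskmetric is $$U_h(Q)=\int_{-\infty}^0\big(h(1-Q(x))-h(1)\big)\,dx+\int_0^\infty h(1-Q(x))\,dx .$$ Write $\Delta^{K-1}$ for the probability simplex and $V(\alpha,G)=U_h\big(\sum_i\alpha(i)G_i\big)$, and assume that $U_h$ is finite at all mixtures $\sum_i\alpha(i)F_i$. Let $\|\cdot\|_{\rm W}$ be the $1$-Wasserstein distance and $$W=\sup_{\alpha\ne\beta\in\Delta^{K-1}}\frac{1}{\|\alpha-\beta\|_1}\Big\|\sum_i\alpha(i)F_i-\sum_i\beta(i)F_i\Big\|_{\rm W}.$$ Assume that $U_h$ is Hölder continuous with exponent $q\in(0,1]$ and constant $\mathcal L>0$: $U_h(G)-U_h(G')\le\mathcal L\,\|G-G'\|_{\rm W}^q$ for all $G,G'$ of the form $\sum_i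 a(i)G_i$ with $a\in\Delta^{K-1}$, where each $G_i$ is either $F_i$ or the empirical distribution of a nonempty finite sample of points of $S$. **Discretization.** For $\varepsilon>0$ let $\Delta^{K-1}_\varepsilon$ be the set of $a\in\Delta^{K-1}$ whose first $K-1$ coordinates are nonnegative integer multiples of $\varepsilon$ (the last coordinate takes up the rest). Let $\alpha^\star$ maximize $V(\cdot,F)$ over $\Delta^{K-1}$ and let $a^\star$ maximize it over $\Delta_\varepsilon^{K-1}$. Put $\Delta(\varepsilon)=V(\alpha^\star,F)-V(a^\star,F)$, $$\Delta_{\min}(\varepsilon)=\min_{a\in\Delta_\varepsilon^{K-1},\,a\ne a^\star}\{V(a^\star,F)-V(a,F)\}\in[0,\infty]$$ (with $\min\emptyset=\infty$) and, for a horizon $T\in\mathbb N$, $$N(\varepsilon)=256Ke\Big(\frac{2K\mathcal L}{\Delta_{\min}(\varepsilon)}\Big)^{2/q}\Big[\frac{32}{\sqrt e}+\sqrt{\log\big(2KT^2(\varepsilon^{-(K-1)}+1)\big)}\Big]^2,\qquad M(\varepsilon)=\frac{N(\varepsilon)}{\log T},$$ where $N(\varepsilon)=\infty$ if $\Delta_{\min}(\varepsilon)=0$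 and $N(\varepsilon)=0$ if $\Delta_{\min}(\varepsilon)=\infty$. **Algorithm RS-ETC-M.** Let $m=\lceil N(\varepsilon)/K\rceil$. *Explore:* in the first $Km$ rounds sample every arm $m$ times, by a fixed schedule. *Estimate:* from these samples form the empirical distributions $\hat F_i$ of the arms and choose (measurably, with any tie-breaking) $\hat a\in\arg\max_{a\in\Delta_\varepsilon^{K-1}}V(a,\hat F)$. *Commit:* go through the arms $i=1,\dots,K-1$ in turn; if $T\hat a(i)>m$, sample arm $i$ until it has been sampled $\lfloor T\hat a(i)\rfloor$ times in total, otherwise skip it; give all remaining rounds to arm $K$. The procedure is stopped after $T$ rounds. The rewards of arm $i$ are i.i.d. with law $F_i$, independently over the arms, and $\tau_T(i)$ is the number of times that arm $i$ is sampled in the first $T$ rounds. The regret is $$\mathfrak R(T)=V(\alpha^\star,F)-\mathbb E\Big[V\Big(\tfrac1T\tau_T,F\Big)\Big].$$ **Theorem.** For every $\varepsilon>0$ and every horizon $T>N(\varepsilon)$, the regret of RS-ETC-M satisfies $$\mathfrak R(T)\le\big(\mathcal LK+W^{-q}\big)\Big(3W\,M(\varepsilon)\,\frac{\log T}{T}\Big)^q+\Delta(\varepsilon),$$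 where $W^{-q}$ is read as $0$ if $W=0$ and $M(\varepsilon)$ is read as $0$ if $N(\varepsilon)=0$. -/

import Mathlib

open MeasureTheory ProbabilityTheory
open scoped ENNReal

namespace RiskBandit

noncomputable section

/-- The distortion riskmetric `U_h(Q)`: the signed Choquet integral of `h` at the law `Q`,
written through the CDF of `Q`. -/
def distortionRisk (h : ℝ → ℝ) (Q : Measure ℝ) : ℝ :=
  (∫ x in Set.Iic (0 : ℝ), (h (1 - cdf Q x) - h 1)) + ∫ x in Set.Ioi (0 : ℝ), h (1 - cdf Q x)

/-- The couplings of two laws on the real line. -/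
def couplings (P Q : Measure ℝ) : Set (Measure (ℝ × ℝ)) :=
  {γ | γ.map Prod.fst = P ∧ γ.map Prod.snd = Q}

/-- The 1-Wasserstein distance: the least expected distance over all couplings. -/
def wasserstein (P Q : Measure ℝ) : ℝ :=
  (⨅ γ ∈ couplings P Q, ∫⁻ z, edist z.1 z.2 ∂γ).toReal

/-- `P` is 1-sub-Gaussian: its tails satisfy `P(|X| > u) ≤ 2 exp(-u²/2)` for all `u ≥ 0`. -/
def IsOneSubGaussian (P : Measure ℝ) : Prop :=
  ∀ u : ℝ, 0 ≤ u → P.real {x | u < |x|} ≤ 2 * Real.exp (-u ^ 2 / 2)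

variable {K : ℕ}

/-- The mixture `∑ i, a i • F i`. -/
def mixture (a : Fin K → ℝ) (F : Fin K → Measure ℝ) : Measure ℝ :=
  ∑ i, ENNReal.ofReal (a i) • F i

/-- `V(a, F) = U_h (∑ i, a i • F i)`. -/
def mixtureValue (h : ℝ → ℝ) (a : Fin K → ℝ) (F : Fin K → Measure ℝ) : ℝ :=
  distortionRisk h (mixture a F)

/-- `W`: the largest ratio between the Wasserstein distance of two mixtures of the arms and the
`ℓ¹` distance of their mixing coefficients. -/
def wassersteinRatio (F : Fin K → Measure ℝ) : ℝ :=
  sSup {w | ∃ α ∈ stdSimplex ℝ (Fin K), ∃ β ∈ stdSimplex ℝ (Fin K), α ≠ β ∧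
    w = 1 / (∑ i, |α i - β i|) * wasserstein (mixture α F) (mixture β F)}

/-- `G` is the empirical distribution of a nonempty finite sample of points of `S`. -/
def IsEmpirical (S : Set ℝ) (G : Measure ℝ) : Prop :=
  ∃ (n : ℕ) (x : Fin n → ℝ), 0 < n ∧ (∀ j, x j ∈ S) ∧
    G = (n : ℝ≥0∞)⁻¹ • ∑ j, Measure.dirac (x j)

/-- The mixtures `∑ i, a i • G i` in which every `G i` is the law `F i` of arm `i` or an empirical
distribution on the support set `S`. The mixtures with `G = F` form the convex hull of the arms;
those with all `G i` empirical are the ones at which the riskmetric is evaluated by an algorithm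
that only sees samples. -/
def mixtureClass (S : Set ℝ) (F : Fin K → Measure ℝ) : Set (Measure ℝ) :=
  {Q | ∃ a ∈ stdSimplex ℝ (Fin K), ∃ G : Fin K → Measure ℝ,
    (∀ i, G i = F i ∨ IsEmpirical S (G i)) ∧ Q = mixture a G}

/-- Hölder continuity of `U_h` with exponent `q` and constant `L` in the Wasserstein distance. -/
def IsHolderRisk (h : ℝ → ℝ) (S : Set ℝ) (F : Fin K → Measure ℝ) (q L : ℝ) : Prop :=
  ∀ G₁ ∈ mixtureClass S F, ∀ G₂ ∈ mixtureClass S F,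
    distortionRisk h G₁ - distortionRisk h G₂ ≤ L * wasserstein G₁ G₂ ^ q

/-- The discretized simplex: all coordinates but the last are multiples of `ε`, and the last one
takes up the rest. If `1 / ε` is an integer, then the last coordinate is a multiple of `ε` too. -/
def discreteSimplex (K : ℕ) (ε : ℝ) : Set (Fin K → ℝ) :=
  {a | a ∈ stdSimplex ℝ (Fin K) ∧ ∀ i : Fin K, (i : ℕ) + 1 < K → ∃ n : ℕ, a i = ε * n}

/-- `a` maximizes `V(·, F)` over `s`. -/
def IsArgmax (h : ℝ → ℝ) (F : Fin K → Measure ℝ) (s : Set (Fin K → ℝ)) (a : Fin K → ℝ) : Prop :=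
  a ∈ s ∧ ∀ b ∈ s, mixtureValue h b F ≤ mixtureValue h a F

/-- The minimum sub-optimality gap: the least value of `V(a⋆, F) - V(a, F)` over the points
`a ≠ a⋆` of the discretized simplex (`∞` if there is no such point). -/
def minGap (h : ℝ → ℝ) (F : Fin K → Measure ℝ) (ε : ℝ) (aStar : Fin K → ℝ) : ℝ≥0∞ :=
  ⨅ a ∈ discreteSimplex K ε \ {aStar},
    ENNReal.ofReal (mixtureValue h aStar F - mixtureValue h a F)

/-- The exploration length `N(ε)`, as a function of `K`, `q`, `L`, `ε`, the gap and the horizon.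
It is `∞` if the gap is `0` (and `L > 0`). -/
def explorationLength (K : ℕ) (q L ε : ℝ) (gap : ℝ≥0∞) (T : ℕ) : ℝ≥0∞ :=
  ENNReal.ofReal (256 * K * Real.exp 1) * (ENNReal.ofReal (2 * K * L) / gap) ^ (2 / q) *
    ENNReal.ofReal ((32 / √(Real.exp 1) +
      √(Real.log (2 * K * (T : ℝ) ^ 2 * (ε ^ (-((K : ℝ) - 1)) + 1)))) ^ 2)

/-- A history of length `t`: the arms selected and the rewards observed. -/
abbrev History (K t : ℕ) : Type := Fin t → Fin K × ℝ

/-- A bandit policy: a measurable choice of the next arm from the history. -/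
structure Policy (K : ℕ) where
  choose : (t : ℕ) → History K t → Fin K
  measurable_choose : ∀ t, Measurable (choose t)

/-- The number of times that arm `i` occurs in a history. -/
def pulls {t : ℕ} (H : History K t) (i : Fin K) : ℕ :=
  (Finset.univ.filter fun s => (H s).1 = i).card

/-- The empirical distribution of the rewards of arm `i` in a history. -/
def empirical {t : ℕ} (H : History K t) (i : Fin K) : Measure ℝ :=
  (pulls H i : ℝ≥0∞)⁻¹ • ∑ s ∈ Finset.univ.filter (fun s => (H s).1 = i), Measure.dirac (H s).2

/-- The history that a policy generates if `y (i, n)` is the reward of the pull of arm `i` that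
follows `n` earlier pulls of this arm. -/
def Policy.history (π : Policy K) (y : Fin K × ℕ → ℝ) : (t : ℕ) → History K t
  | 0 => Fin.elim0
  | t + 1 =>
    let H := π.history y t
    let i := π.choose t H
    Fin.snoc (α := fun _ => Fin K × ℝ) H (i, y (i, pulls H i))

/-- The joint law of all rewards: independent, those of arm `i` distributed according to `F i`. -/
def rewardLaw (F : Fin K → Measure ℝ) [∀ i, IsProbabilityMeasure (F i)] :
    Measure (Fin K × ℕ → ℝ) :=
  Measure.infinitePi fun p : Fin K × ℕ => F p.1

/-- The regret at horizon `T`: the value at the optimal mixture `αStar` minus the expected value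
at the arm selection frequencies of the policy. -/
def regret (h : ℝ → ℝ) (F : Fin K → Measure ℝ) [∀ i, IsProbabilityMeasure (F i)]
    (αStar : Fin K → ℝ) (π : Policy K) (T : ℕ) : ℝ :=
  mixtureValue h αStar F -
    ∫ y, mixtureValue h (fun i => (pulls (π.history y T) i : ℝ) / T) F ∂(rewardLaw F)

/-- Arm `i` is one of the first `K - 1` arms, its target `T * a i` exceeds the `m` exploration
samples, and it was pulled (`c i` times) less often than `⌊T * a i⌋`. -/
def NeedsSampling (T m : ℕ) (a : Fin K → ℝ) (c : Fin K → ℕ) (i : Fin K) : Prop :=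
  (i : ℕ) + 1 < K ∧ (m : ℝ) < T * a i ∧ c i < ⌊T * a i⌋₊

open scoped Classical in
/-- The commit rule: go through the first `K - 1` arms in turn, sample each one up to its target,
then give the remaining budget to the last arm. -/
def commitArm (hK : 0 < K) (T m : ℕ) (a : Fin K → ℝ) (c : Fin K → ℕ) : Fin K :=
  if hne : (Finset.univ.filter (NeedsSampling T m a c)).Nonempty then
    (Finset.univ.filter (NeedsSampling T m a c)).min' hne
  else ⟨K - 1, Nat.sub_lt hK Nat.one_pos⟩

/-- `π` is an explore-then-commit mixture policy for horizon `T`, discretization level `ε` and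
`m` exploration samples per arm. In the first `K * m` rounds it follows a fixed schedule that
contains every arm `m` times. From the resulting history `H` it computes a maximizer `est H` of
the riskmetric of the empirical mixtures over the discretized simplex, by any tie-breaking rule.
From then on it follows the commit rule for `est H`. -/
def IsETCMixture (hK : 0 < K) (h : ℝ → ℝ) (ε : ℝ) (T m : ℕ) (π : Policy K) : Prop :=
  ∃ (sched : Fin (K * m) → Fin K) (est : History K (K * m) → Fin K → ℝ),
    (∀ i, (Finset.univ.filter fun s => sched s = i).card = m) ∧
    (∀ H : History K (K * m), (∀ i, pulls H i = m) →
      IsArgmax h (empirical H) (discreteSimplex K ε) (est H)) ∧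
    (∀ (t : ℕ) (ht : t < K * m) (H : History K t), π.choose t H = sched ⟨t, ht⟩) ∧
    (∀ (t : ℕ) (ht : K * m ≤ t) (H : History K t),
      π.choose t H = commitArm hK T m (est fun s => H (Fin.castLE ht s)) (pulls H))

end

end RiskBandit

namespace RiskBandit

/-- The quantile function of `P` on `(0, 1)`, extended by `0`. -/
noncomputable def quantile (P : Measure ℝ) (u : ℝ) : ℝ :=
  open scoped Classical in if u ∈ Set.Ioo (0 : ℝ) 1 then sInf {x | u ≤ cdf P x} else 0

theorem quantile_le_iff (P : Measure ℝ) {u : ℝ} (hu : u ∈ Set.Ioo (0 : ℝ) 1) (x : ℝ) :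
    quantile P u ≤ x ↔ u ≤ cdf P x := by
  classical
  rw [quantile, if_pos hu]
  have hbdd : BddBelow {x | u ≤ cdf P x} := by
    obtain ⟨y, hy⟩ := ((tendsto_cdf_atBot P).eventually (gt_mem_nhds hu.1)).exists
    refine ⟨y, fun z hz => ?_⟩
    by_contra! hzy
    exact absurd (hz.trans (monotone_cdf P hzy.le)) (not_le.2 hy)
  have hne : {x | u ≤ cdf P x}.Nonempty := by
    obtain ⟨y, hy⟩ := ((tendsto_cdf_atTop P).eventually (lt_mem_nhds hu.2)).exists
    exact ⟨y, hy.le⟩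
  refine ⟨fun h => ?_, fun h => csInf_le hbdd h⟩
  have hcont : Filter.Tendsto (cdf P) (nhdsWithin x (Set.Ioi x)) (nhds (cdf P x)) :=
    (continuousWithinAt_Ioi_iff_Ici.2 ((cdf P).right_continuous x))
  refine ge_of_tendsto hcont ?_
  filter_upwards [self_mem_nhdsWithin] with y hy
  obtain ⟨z, hz, hzy⟩ := exists_lt_of_csInf_lt hne (lt_of_le_of_lt h hy)
  exact le_trans hz (monotone_cdf P hzy.le)

theorem measurable_quantile (P : Measure ℝ) : Measurable (quantile P) := by
  classical
  refine measurable_of_Iic fun x => ?_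
  have : quantile P ⁻¹' Set.Iic x =
      (Set.Ioo (0 : ℝ) 1 ∩ Set.Iic (cdf P x)) ∪ ((Set.Ioo (0 : ℝ) 1)ᶜ ∩ {_u | 0 ≤ x}) := by
    ext u
    by_cases hu : u ∈ Set.Ioo (0 : ℝ) 1
    · have := quantile_le_iff P hu x
      simp only [Set.mem_preimage, Set.mem_Iic, Set.mem_union, Set.mem_inter_iff, hu, true_and,
        Set.mem_compl_iff, not_true, false_and, or_false, this]
    · have : quantile P u = 0 := if_neg hu
      simp only [Set.mem_preimage, Set.mem_Iic, Set.mem_union, Set.mem_inter_iff, hu, false_and,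
        Set.mem_compl_iff, not_false_iff, true_and, false_or, this]
      rfl
  rw [this]
  exact (measurableSet_Ioo.inter measurableSet_Iic).union
    (measurableSet_Ioo.compl.inter (MeasurableSet.const _))

instance isProbabilityMeasure_restrict_Ioo :
    IsProbabilityMeasure (volume.restrict (Set.Ioo (0 : ℝ) 1)) := ⟨by simp⟩

theorem map_quantile (P : Measure ℝ) [IsProbabilityMeasure P] :
    (volume.restrict (Set.Ioo (0 : ℝ) 1)).map (quantile P) = P := by
  have := Measure.isProbabilityMeasure_map (μ := volume.restrict (Set.Ioo (0 : ℝ) 1))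
    (measurable_quantile P).aemeasurable
  refine Measure.ext_of_Iic _ _ fun x => ?_
  rw [Measure.map_apply (measurable_quantile P) measurableSet_Iic,
    Measure.restrict_apply (measurable_quantile P measurableSet_Iic), ← ofReal_cdf]
  have h0 := cdf_nonneg P x
  have h1 := cdf_le_one P x
  refine le_antisymm ?_ ?_
  · calc volume (quantile P ⁻¹' Set.Iic x ∩ Set.Ioo 0 1)
        ≤ volume (Set.Ioc 0 (cdf P x)) := by
          refine measure_mono fun u hu => ?_
          exact ⟨hu.2.1, (quantile_le_iff P hu.2 x).1 hu.1⟩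
      _ = _ := by simp
  · calc ENNReal.ofReal (cdf P x) = volume (Set.Ioo 0 (cdf P x)) := by simp
      _ ≤ _ := by
          refine measure_mono fun u hu => ?_
          have hu' : u ∈ Set.Ioo (0 : ℝ) 1 := ⟨hu.1, hu.2.trans_le h1⟩
          exact ⟨(quantile_le_iff P hu' x).2 hu.2.le, hu'⟩

theorem lintegral_abs_step_sub_step (a b : ℝ) :
    ∫⁻ x, ENNReal.ofReal |(Set.Ici a).indicator (1 : ℝ → ℝ) x - (Set.Ici b).indicator 1 x| =
      edist a b := by
  have key : ∀ a b : ℝ, a ≤ b →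
      ∫⁻ x, ENNReal.ofReal |(Set.Ici a).indicator (1 : ℝ → ℝ) x - (Set.Ici b).indicator 1 x| =
        edist a b := by
    intro a b hab
    have : ∀ x, ENNReal.ofReal |(Set.Ici a).indicator (1 : ℝ → ℝ) x - (Set.Ici b).indicator 1 x|
        = (Set.Ico a b).indicator 1 x := by
      intro x
      by_cases h1 : a ≤ x <;> by_cases h2 : b ≤ x
      · simp [Set.indicator, h1, h2, not_lt.2 h2]
      · simp [Set.indicator, h1, h2, not_le.1 h2]
      · exact absurd (hab.trans h2) h1
      · simp [Set.indicator, h1, h2]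
    simp_rw [this]
    rw [lintegral_indicator_one measurableSet_Ico, Real.volume_Ico, edist_comm, edist_dist,
      Real.dist_eq, abs_of_nonneg (by linarith)]
  rcases le_total a b with h | h
  · exact key a b h
  · rw [edist_comm, ← key b a h]
    simp_rw [abs_sub_comm]

/-- The `L¹` distance of the distribution functions. -/
noncomputable def cdfDist (P Q : Measure ℝ) : ℝ≥0∞ :=
  ∫⁻ x, ENNReal.ofReal |cdf P x - cdf Q x|

theorem lintegral_edist_quantile (P Q : Measure ℝ) :
    ∫⁻ u in Set.Ioo (0 : ℝ) 1, edist (quantile P u) (quantile Q u) = cdfDist P Q := by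
  have hm : ∀ P : Measure ℝ, Measurable fun z : ℝ × ℝ =>
      (Set.Ici (quantile P z.1)).indicator (1 : ℝ → ℝ) z.2 := by
    intro P
    have : (fun z : ℝ × ℝ => (Set.Ici (quantile P z.1)).indicator (1 : ℝ → ℝ) z.2) =
        Set.indicator {z : ℝ × ℝ | quantile P z.1 ≤ z.2} 1 := by
      ext z; simp [Set.indicator]
    rw [this]
    exact measurable_one.indicator
      (measurableSet_le ((measurable_quantile P).comp measurable_fst) measurable_snd)
  simp_rw [← lintegral_abs_step_sub_step]
  rw [lintegral_lintegral_swap]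
  swap
  · exact (((hm P).sub (hm Q)).abs).ennreal_ofReal.aemeasurable
  refine lintegral_congr fun x => ?_
  set p := cdf P x with hp
  set r := cdf Q x with hr
  have hp0 := cdf_nonneg P x
  have hp1 := cdf_le_one P x
  have hr0 := cdf_nonneg Q x
  have hr1 := cdf_le_one Q x
  rw [← hp] at hp0 hp1
  rw [← hr] at hr0 hr1
  have : ∀ u ∈ Set.Ioo (0 : ℝ) 1, ENNReal.ofReal |(Set.Ici (quantile P u)).indicator (1 : ℝ → ℝ) x
      - (Set.Ici (quantile Q u)).indicator 1 x| = (Set.Ioc (min p r) (max p r)).indicator 1 u := by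
    intro u hu
    have h1 := quantile_le_iff P hu x
    have h2 := quantile_le_iff Q hu x
    simp only [Set.indicator, Set.mem_Ici, h1, h2, ← hp, ← hr, Set.mem_Ioc, min_lt_iff,
      le_max_iff, Pi.one_apply]
    by_cases h3 : u ≤ p <;> by_cases h4 : u ≤ r <;>
      simp [h3, h4, not_lt.2, not_le.1]
  rw [setLIntegral_congr_fun measurableSet_Ioo this, setLIntegral_congr Ioo_ae_eq_Ioc,
    lintegral_indicator_one measurableSet_Ioc, Measure.restrict_apply measurableSet_Ioc,
    Set.Ioc_inter_Ioc, Real.volume_Ioc, max_eq_left (le_min hp0 hr0), min_eq_left (max_le hp1 hr1),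
    max_sub_min_eq_abs']

theorem wasserstein_le_cdfDist (P Q : Measure ℝ) [IsProbabilityMeasure P] [IsProbabilityMeasure Q]
    (h : cdfDist P Q ≠ ∞) : wasserstein P Q ≤ (cdfDist P Q).toReal := by
  refine ENNReal.toReal_mono h ?_
  have hm : Measurable fun u => (quantile P u, quantile Q u) :=
    (measurable_quantile P).prodMk (measurable_quantile Q)
  refine (iInf₂_le ((volume.restrict (Set.Ioo (0 : ℝ) 1)).map
    fun u => (quantile P u, quantile Q u)) ⟨?_, ?_⟩).trans ?_
  · rw [lintegral_map (by fun_prop) hm, ← lintegral_edist_quantile]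
  · rw [Measure.map_map measurable_fst hm]
    exact map_quantile P
  · rw [Measure.map_map measurable_snd hm]
    exact map_quantile Q

section Mixture

variable {K : ℕ}

theorem isProbabilityMeasure_mixture {a : Fin K → ℝ} (ha : a ∈ stdSimplex ℝ (Fin K))
    (F : Fin K → Measure ℝ) [∀ i, IsProbabilityMeasure (F i)] :
    IsProbabilityMeasure (mixture a F) := by
  constructor
  simp only [mixture, Measure.coe_finsetSum, Finset.sum_apply, Measure.smul_apply, measure_univ,
    smul_eq_mul, mul_one]
  rw [← ENNReal.ofReal_sum_of_nonneg fun i _ => ha.1 i, ha.2, ENNReal.ofReal_one]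

theorem cdf_mixture {a : Fin K → ℝ} (ha : a ∈ stdSimplex ℝ (Fin K))
    (F : Fin K → Measure ℝ) [∀ i, IsProbabilityMeasure (F i)] (x : ℝ) :
    cdf (mixture a F) x = ∑ i, a i * cdf (F i) x := by
  have := isProbabilityMeasure_mixture ha F
  rw [cdf_eq_real, measureReal_def]
  simp only [mixture, Measure.coe_finsetSum, Finset.sum_apply, Measure.smul_apply, smul_eq_mul]
  rw [ENNReal.toReal_sum fun i _ => ENNReal.mul_ne_top ENNReal.ofReal_ne_top (measure_ne_top _ _)]
  refine Finset.sum_congr rfl fun i _ => ?_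
  rw [ENNReal.toReal_mul, ENNReal.toReal_ofReal (ha.1 i), cdf_eq_real, measureReal_def]

theorem measurable_cdf (P : Measure ℝ) : Measurable (cdf P) := (monotone_cdf P).measurable

theorem lintegral_sum_mul_abs_le (c : Fin K → ℝ) (hc : ∀ i, 0 ≤ c i) (f : Fin K → ℝ → ℝ)
    (hf : ∀ i, Measurable (f i)) (g : ℝ → ℝ) (hg : ∀ x, |g x| ≤ ∑ i, c i * |f i x|) :
    ∫⁻ x, ENNReal.ofReal |g x| ≤
      ∑ i, ENNReal.ofReal (c i) * ∫⁻ x, ENNReal.ofReal |f i x| := by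
  calc ∫⁻ x, ENNReal.ofReal |g x|
      ≤ ∫⁻ x, ∑ i, ENNReal.ofReal (c i) * ENNReal.ofReal |f i x| := by
        refine lintegral_mono fun x => ?_
        refine (ENNReal.ofReal_le_ofReal (hg x)).trans_eq ?_
        rw [ENNReal.ofReal_sum_of_nonneg fun i _ => mul_nonneg (hc i) (abs_nonneg _)]
        simp_rw [ENNReal.ofReal_mul (hc _)]
    _ = _ := by
        rw [lintegral_finsetSum _ fun i _ => ((hf i).abs.ennreal_ofReal.const_mul _)]
        simp_rw [lintegral_const_mul _ (hf _).abs.ennreal_ofReal]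

/-- Two mixtures with the same weights are as close as their components. -/
theorem wasserstein_mixture_le {a : Fin K → ℝ} (ha : a ∈ stdSimplex ℝ (Fin K))
    (F G : Fin K → Measure ℝ) [∀ i, IsProbabilityMeasure (F i)] [∀ i, IsProbabilityMeasure (G i)]
    (h : ∀ i, cdfDist (F i) (G i) ≠ ∞) :
    wasserstein (mixture a F) (mixture a G) ≤ ∑ i, a i * (cdfDist (F i) (G i)).toReal := by
  have := isProbabilityMeasure_mixture ha F
  have := isProbabilityMeasure_mixture ha G
  have key : cdfDist (mixture a F) (mixture a G) ≤
      ∑ i, ENNReal.ofReal (a i) * cdfDist (F i) (G i) := by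
    refine lintegral_sum_mul_abs_le a ha.1 (fun i x => cdf (F i) x - cdf (G i) x)
      (fun i => (measurable_cdf _).sub (measurable_cdf _)) _ fun x => ?_
    rw [cdf_mixture ha, cdf_mixture ha, ← Finset.sum_sub_distrib]
    refine (Finset.abs_sum_le_sum_abs _ _).trans (Finset.sum_le_sum fun i _ => ?_)
    rw [← mul_sub, abs_mul, abs_of_nonneg (ha.1 i)]
  have hfin : ∑ i, ENNReal.ofReal (a i) * cdfDist (F i) (G i) ≠ ∞ :=
    ENNReal.sum_ne_top.2 fun i _ => ENNReal.mul_ne_top ENNReal.ofReal_ne_top (h i)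
  refine (wasserstein_le_cdfDist _ _ (ne_top_of_le_ne_top hfin key)).trans
    ((ENNReal.toReal_mono hfin key).trans_eq ?_)
  rw [ENNReal.toReal_sum fun i _ => ENNReal.mul_ne_top ENNReal.ofReal_ne_top (h i)]
  simp_rw [ENNReal.toReal_mul, ENNReal.toReal_ofReal (ha.1 _)]

/-- Mixtures of the same components are close if their weights are. -/
theorem wasserstein_mixture_le_of_weights {α β : Fin K → ℝ} (hα : α ∈ stdSimplex ℝ (Fin K))
    (hβ : β ∈ stdSimplex ℝ (Fin K)) (F : Fin K → Measure ℝ) [∀ i, IsProbabilityMeasure (F i)]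
    (D : Measure ℝ) {C : ℝ} (hC : 0 ≤ C) (h : ∀ i, cdfDist (F i) D ≤ ENNReal.ofReal C) :
    wasserstein (mixture α F) (mixture β F) ≤ C * ∑ i, |α i - β i| := by
  have := isProbabilityMeasure_mixture hα F
  have := isProbabilityMeasure_mixture hβ F
  have key : cdfDist (mixture α F) (mixture β F) ≤
      ∑ i, ENNReal.ofReal |α i - β i| * cdfDist (F i) D := by
    refine lintegral_sum_mul_abs_le _ (fun _ => abs_nonneg _) (fun i x => cdf (F i) x - cdf D x)
      (fun i => (measurable_cdf _).sub (measurable_cdf _)) _ fun x => ?_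
    have : cdf (mixture α F) x - cdf (mixture β F) x =
        ∑ i, (α i - β i) * (cdf (F i) x - cdf D x) := by
      rw [cdf_mixture hα, cdf_mixture hβ]
      simp_rw [mul_sub, Finset.sum_sub_distrib, ← Finset.sum_mul, Finset.sum_sub_distrib, hα.2,
        hβ.2, sub_mul, Finset.sum_sub_distrib]
      ring
    rw [this]
    refine (Finset.abs_sum_le_sum_abs _ _).trans (Finset.sum_le_sum fun i _ => ?_)
    rw [abs_mul]
  have key2 : cdfDist (mixture α F) (mixture β F) ≤
      ENNReal.ofReal (C * ∑ i, |α i - β i|) := by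
    refine key.trans ?_
    rw [Finset.mul_sum, ENNReal.ofReal_sum_of_nonneg fun i _ => mul_nonneg hC (abs_nonneg _)]
    refine Finset.sum_le_sum fun i _ => ?_
    rw [ENNReal.ofReal_mul hC, mul_comm]
    gcongr
    exact h i
  refine (wasserstein_le_cdfDist _ _ (ne_top_of_le_ne_top ENNReal.ofReal_ne_top key2)).trans ?_
  exact ENNReal.toReal_le_of_le_ofReal
    (mul_nonneg hC (Finset.sum_nonneg fun _ _ => abs_nonneg _)) key2

theorem wassersteinRatio_nonneg (F : Fin K → Measure ℝ) : 0 ≤ wassersteinRatio F := by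
  refine Real.sSup_nonneg fun w hw => ?_
  obtain ⟨α, -, β, -, -, rfl⟩ := hw
  exact mul_nonneg (one_div_nonneg.2 (Finset.sum_nonneg fun _ _ => abs_nonneg _))
    ENNReal.toReal_nonneg

theorem sum_abs_sub_pos {α β : Fin K → ℝ} (h : α ≠ β) : 0 < ∑ i, |α i - β i| := by
  obtain ⟨i, hi⟩ := Function.ne_iff.1 h
  exact Finset.sum_pos' (fun _ _ => abs_nonneg _) ⟨i, Finset.mem_univ _, abs_pos.2 (sub_ne_zero.2 hi)⟩

theorem wasserstein_mixture_le_ratio {α β : Fin K → ℝ} (hα : α ∈ stdSimplex ℝ (Fin K))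
    (hβ : β ∈ stdSimplex ℝ (Fin K)) (F : Fin K → Measure ℝ) [∀ i, IsProbabilityMeasure (F i)]
    (D : Measure ℝ) {C : ℝ} (hC : 0 ≤ C) (h : ∀ i, cdfDist (F i) D ≤ ENNReal.ofReal C) :
    wasserstein (mixture α F) (mixture β F) ≤ wassersteinRatio F * ∑ i, |α i - β i| := by
  rcases eq_or_ne α β with rfl | hne
  · simpa using wasserstein_mixture_le_of_weights hα hα F D hC h
  have hpos := sum_abs_sub_pos hne
  have hle : 1 / (∑ i, |α i - β i|) * wasserstein (mixture α F) (mixture β F) ≤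
      wassersteinRatio F := by
    refine le_csSup ⟨C, ?_⟩ ⟨α, hα, β, hβ, hne, rfl⟩
    rintro w ⟨α', hα', β', hβ', hne', rfl⟩
    have hpos' := sum_abs_sub_pos hne'
    rw [one_div, inv_mul_le_iff₀ hpos', mul_comm]
    exact wasserstein_mixture_le_of_weights hα' hβ' F D hC h
  rwa [one_div, inv_mul_le_iff₀ hpos, mul_comm] at hle

end Mixture

theorem IsOneSubGaussian.measure_lt_abs_le {μ : Measure ℝ} [IsProbabilityMeasure μ]
    (h : IsOneSubGaussian μ) {u : ℝ} (hu : 0 ≤ u) :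
    μ {x | u < |x|} ≤ ENNReal.ofReal (2 * Real.exp (-u ^ 2 / 2)) := by
  rw [← ofReal_measureReal]
  exact ENNReal.ofReal_le_ofReal (h u hu)

theorem IsOneSubGaussian.lintegral_exp_sq_le {μ : Measure ℝ} [IsProbabilityMeasure μ]
    (h : IsOneSubGaussian μ) : ∫⁻ x, ENNReal.ofReal (Real.exp (x ^ 2 / 4)) ∂μ ≤ 3 := by
  rw [lintegral_eq_lintegral_meas_lt μ (Filter.Eventually.of_forall fun _ => (Real.exp_pos _).le)
    (by fun_prop), ← Set.Ioc_union_Ioi_eq_Ioi zero_le_one,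
    lintegral_union measurableSet_Ioi (Set.disjoint_left.2 fun x h1 h2 => not_lt.2 h1.2 h2)]
  have h1 : ∫⁻ t in Set.Ioc (0 : ℝ) 1, μ {a : ℝ | t < Real.exp (a ^ 2 / 4)} ≤ 1 := by
    calc _ ≤ ∫⁻ t in Set.Ioc (0 : ℝ) 1, 1 := lintegral_mono fun t => prob_le_one
      _ = 1 := by simp
  have h2 : ∫⁻ t in Set.Ioi (1 : ℝ), μ {a : ℝ | t < Real.exp (a ^ 2 / 4)} ≤ 2 := by
    calc _ ≤ ∫⁻ t in Set.Ioi (1 : ℝ), ENNReal.ofReal (2 * t ^ (-2 : ℝ)) := by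
          refine setLIntegral_mono (by fun_prop) fun t ht => ?_
          have ht : 1 < t := ht
          have hlog : 0 ≤ Real.log t := Real.log_nonneg ht.le
          refine (measure_mono (t := {x | 2 * √(Real.log t) < |x|}) fun a ha => ?_).trans
            ((h.measure_lt_abs_le (by positivity)).trans_eq ?_)
          · have ha : t < Real.exp (a ^ 2 / 4) := ha
            have : Real.log t < a ^ 2 / 4 := by
              rwa [Real.log_lt_iff_lt_exp (by linarith)]
            refine lt_of_pow_lt_pow_left₀ 2 (abs_nonneg a) ?_
            rw [mul_pow, Real.sq_sqrt hlog, sq_abs]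
            linarith
          · rw [mul_pow, Real.sq_sqrt hlog, Real.rpow_def_of_pos (by linarith)]
            congr 3
            ring
      _ = ENNReal.ofReal (∫ t in Set.Ioi (1 : ℝ), 2 * t ^ (-2 : ℝ)) := by
          rw [ofReal_integral_eq_lintegral_ofReal]
          · exact (integrableOn_Ioi_rpow_of_lt (by norm_num) zero_lt_one).const_mul 2
          · refine (ae_restrict_mem measurableSet_Ioi).mono fun t ht => ?_
            have ht : (1 : ℝ) < t := ht
            have : 0 < t := by linarith
            show (0 : ℝ) ≤ 2 * t ^ (-2 : ℝ)
            positivity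
      _ = 2 := by
          rw [integral_const_mul, integral_Ioi_rpow_of_lt (by norm_num) zero_lt_one]
          norm_num
  calc _ ≤ (1 : ℝ≥0∞) + 2 := add_le_add h1 h2
    _ = 3 := by norm_num

theorem IsOneSubGaussian.lintegral_exp_mul_sq_le {μ : Measure ℝ} [IsProbabilityMeasure μ]
    (h : IsOneSubGaussian μ) {s : ℝ} (hs : s ^ 2 ≤ 1 / 2) :
    ∫⁻ x, ENNReal.ofReal (Real.exp (s ^ 2 * x ^ 2 / 2)) ∂μ ≤ ENNReal.ofReal (1 + 4 * s ^ 2) := by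
  have hθ : 0 ≤ 1 - 2 * s ^ 2 := by linarith
  calc _ ≤ ∫⁻ x, (ENNReal.ofReal (1 - 2 * s ^ 2) + ENNReal.ofReal (2 * s ^ 2) *
          ENNReal.ofReal (Real.exp (x ^ 2 / 4))) ∂μ := by
        refine lintegral_mono fun x => ?_
        rw [← ENNReal.ofReal_mul (by positivity), ← ENNReal.ofReal_add hθ (by positivity)]
        refine ENNReal.ofReal_le_ofReal ?_
        have := convexOn_exp.2 (Set.mem_univ (0 : ℝ)) (Set.mem_univ (x ^ 2 / 4)) hθ
          (by positivity : 0 ≤ 2 * s ^ 2) (by ring)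
        simp only [smul_eq_mul, mul_zero, zero_add, Real.exp_zero, mul_one] at this
        rwa [show s ^ 2 * x ^ 2 / 2 = 2 * s ^ 2 * (x ^ 2 / 4) by ring]
    _ ≤ ENNReal.ofReal (1 - 2 * s ^ 2) + ENNReal.ofReal (2 * s ^ 2) * 3 := by
        rw [lintegral_add_left (by fun_prop), lintegral_const_mul _ (by fun_prop), lintegral_const,
          measure_univ, mul_one]
        gcongr
        exact h.lintegral_exp_sq_le
    _ = ENNReal.ofReal (1 + 4 * s ^ 2) := by
        rw [show (3 : ℝ≥0∞) = ENNReal.ofReal 3 by norm_num, ← ENNReal.ofReal_mul (by positivity),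
          ← ENNReal.ofReal_add hθ (by positivity)]
        congr 1
        ring

theorem IsOneSubGaussian.lintegral_cosh_sub_le {μ : Measure ℝ} [IsProbabilityMeasure μ]
    (h : IsOneSubGaussian μ) (h0 : ∀ᵐ x ∂μ, 0 ≤ x) {s : ℝ} (hs : s ^ 2 ≤ 1 / 2) :
    ∫⁻ x, ∫⁻ y, ENNReal.ofReal (Real.cosh (s * (x - y))) ∂μ ∂μ ≤
      ENNReal.ofReal (Real.exp (8 * s ^ 2)) := by
  calc _ ≤ ∫⁻ x, ∫⁻ y, ENNReal.ofReal (Real.exp (s ^ 2 * x ^ 2 / 2)) *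
          ENNReal.ofReal (Real.exp (s ^ 2 * y ^ 2 / 2)) ∂μ ∂μ := by
        refine lintegral_mono_ae (h0.mono fun x hx => lintegral_mono_ae (h0.mono fun y hy => ?_))
        rw [← ENNReal.ofReal_mul (Real.exp_pos _).le, ← Real.exp_add]
        refine ENNReal.ofReal_le_ofReal ((Real.cosh_le_exp_half_sq _).trans ?_)
        rw [Real.exp_le_exp]
        have : 0 ≤ s ^ 2 * (x * y) := mul_nonneg (sq_nonneg s) (mul_nonneg hx hy)
        nlinarith
    _ = (∫⁻ x, ENNReal.ofReal (Real.exp (s ^ 2 * x ^ 2 / 2)) ∂μ) *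
          ∫⁻ x, ENNReal.ofReal (Real.exp (s ^ 2 * x ^ 2 / 2)) ∂μ := by
        rw [lintegral_lintegral_mul (by fun_prop) (by fun_prop)]
    _ ≤ ENNReal.ofReal (1 + 4 * s ^ 2) * ENNReal.ofReal (1 + 4 * s ^ 2) := by
        gcongr <;> exact h.lintegral_exp_mul_sq_le hs
    _ ≤ _ := by
        rw [← ENNReal.ofReal_mul (by positivity)]
        refine ENNReal.ofReal_le_ofReal ?_
        have h1 : 1 + 4 * s ^ 2 ≤ Real.exp (4 * s ^ 2) := by
          linarith [Real.add_one_le_exp (4 * s ^ 2)]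
        rw [show 8 * s ^ 2 = 4 * s ^ 2 + 4 * s ^ 2 by ring, Real.exp_add]
        gcongr

theorem ofReal_integral_le_lintegral_ofReal {α : Type*} [MeasurableSpace α] {μ : Measure α}
    {f : α → ℝ} (hf : Integrable f μ) : ENNReal.ofReal (∫ x, f x ∂μ) ≤
      ∫⁻ x, ENNReal.ofReal (f x) ∂μ := by
  rw [integral_eq_lintegral_pos_part_sub_lintegral_neg_part hf]
  refine (ENNReal.ofReal_le_ofReal (sub_le_self _ ENNReal.toReal_nonneg)).trans ?_
  exact ENNReal.ofReal_toReal_le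

theorem IsOneSubGaussian.lintegral_exp_sub_integral_le {μ : Measure ℝ} [IsProbabilityMeasure μ]
    (h : IsOneSubGaussian μ) (h0 : ∀ᵐ x ∂μ, 0 ≤ x) {s : ℝ} (hs : s ^ 2 ≤ 1 / 2) {φ : ℝ → ℝ}
    (hφ : ∀ x y, |φ x - φ y| ≤ |x - y|) (hφm : Measurable φ) (hint : Integrable φ μ) :
    ∫⁻ x, ENNReal.ofReal (Real.exp (s * (φ x - ∫ y, φ y ∂μ))) ∂μ ≤
      ENNReal.ofReal (Real.exp (8 * s ^ 2)) := by
  set m := ∫ y, φ y ∂μ with hm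
  have jensen : 1 ≤ ∫⁻ y, ENNReal.ofReal (Real.exp (s * (m - φ y))) ∂μ := by
    have hi0 : Integrable (fun y => s * (m - φ y)) μ :=
      ((integrable_const m).sub hint).const_mul s
    have hi : Integrable (fun y => s * (m - φ y) + 1) μ := hi0.add (integrable_const 1)
    have hval : ∫ y, (s * (m - φ y) + 1) ∂μ = 1 := by
      rw [integral_add hi0 (integrable_const 1),
        integral_const_mul, integral_sub (integrable_const m) hint]
      simp [← hm]
    calc (1 : ℝ≥0∞) = ENNReal.ofReal (∫ y, (s * (m - φ y) + 1) ∂μ) := by rw [hval]; simp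
      _ ≤ _ := ofReal_integral_le_lintegral_ofReal hi
      _ ≤ _ := lintegral_mono fun y => ENNReal.ofReal_le_ofReal (Real.add_one_le_exp _)
  set A := ∫⁻ x, ∫⁻ y, ENNReal.ofReal (Real.exp (s * (φ x - φ y))) ∂μ ∂μ with hA
  have hle : ∫⁻ x, ENNReal.ofReal (Real.exp (s * (φ x - m))) ∂μ ≤ A := by
    refine lintegral_mono fun x => ?_
    calc ENNReal.ofReal (Real.exp (s * (φ x - m)))
        ≤ ENNReal.ofReal (Real.exp (s * (φ x - m))) *
          ∫⁻ y, ENNReal.ofReal (Real.exp (s * (m - φ y))) ∂μ := le_mul_of_one_le_right' jensen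
      _ = _ := by
        rw [← lintegral_const_mul _ (by fun_prop)]
        refine lintegral_congr fun y => ?_
        rw [← ENNReal.ofReal_mul (Real.exp_pos _).le, ← Real.exp_add]
        ring_nf
  have hswap : A = ∫⁻ x, ∫⁻ y, ENNReal.ofReal (Real.exp (-(s * (φ x - φ y)))) ∂μ ∂μ := by
    rw [hA, lintegral_lintegral_swap (by fun_prop)]
    refine lintegral_congr fun x => lintegral_congr fun y => ?_
    ring_nf
  have hsum : 2 * A ≤ 2 * ENNReal.ofReal (Real.exp (8 * s ^ 2)) := by
    calc 2 * A = A + A := two_mul A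
      _ = ∫⁻ x, ∫⁻ y, 2 * ENNReal.ofReal (Real.cosh (s * (φ x - φ y))) ∂μ ∂μ := by
          nth_rw 2 [hswap]
          rw [hA, ← lintegral_add_left (by fun_prop)]
          refine lintegral_congr fun x => ?_
          rw [← lintegral_add_left (by fun_prop)]
          refine lintegral_congr fun y => ?_
          rw [← ENNReal.ofReal_add (Real.exp_pos _).le (Real.exp_pos _).le, ← ENNReal.ofReal_ofNat 2,
            ← ENNReal.ofReal_mul (by norm_num), Real.cosh_eq]
          congr 1
          ring
      _ ≤ ∫⁻ x, ∫⁻ y, 2 * ENNReal.ofReal (Real.cosh (s * (x - y))) ∂μ ∂μ := by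
          refine lintegral_mono fun x => lintegral_mono fun y => ?_
          refine mul_le_mul_right (ENNReal.ofReal_le_ofReal ?_) _
          rw [Real.cosh_le_cosh, abs_mul, abs_mul]
          exact mul_le_mul_of_nonneg_left (hφ x y) (abs_nonneg s)
      _ = 2 * ∫⁻ x, ∫⁻ y, ENNReal.ofReal (Real.cosh (s * (x - y))) ∂μ ∂μ := by
          rw [← lintegral_const_mul' _ _ (by norm_num)]
          simp_rw [lintegral_const_mul' (2 : ℝ≥0∞) _ (by norm_num)]
      _ ≤ _ := by
          gcongr
          exact h.lintegral_cosh_sub_le h0 hs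
  exact hle.trans ((ENNReal.mul_le_mul_iff_right (by norm_num) (by norm_num)).1 hsum)

theorem IsOneSubGaussian.integrable_id {μ : Measure ℝ} [IsProbabilityMeasure μ]
    (h : IsOneSubGaussian μ) : Integrable (fun x => x) μ := by
  refine ⟨by fun_prop, ?_⟩
  rw [hasFiniteIntegral_iff_norm]
  refine lt_of_le_of_lt ?_ (lt_of_le_of_lt h.lintegral_exp_sq_le (by norm_num))
  refine lintegral_mono fun x => ENNReal.ofReal_le_ofReal ?_
  have := Real.add_one_le_exp (x ^ 2 / 4)
  rw [Real.norm_eq_abs]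
  nlinarith [sq_nonneg (|x| - 2), sq_abs x]

theorem continuous_of_abs_sub_le_sum {n : ℕ} {f : (Fin n → ℝ) → ℝ}
    (hf : ∀ x y, |f x - f y| ≤ ∑ i, |x i - y i|) : Continuous f := by
  refine continuous_iff_continuousAt.2 fun x => ?_
  rw [ContinuousAt, tendsto_iff_dist_tendsto_zero]
  refine squeeze_zero (fun _ => dist_nonneg) (fun y => hf y x) ?_
  have : Continuous fun y : Fin n → ℝ => ∑ i, |y i - x i| := by fun_prop
  simpa using this.tendsto x

theorem integrable_of_abs_sub_le_sum {n : ℕ} {μ : Measure ℝ} [IsProbabilityMeasure μ]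
    (hμ : Integrable (fun x => x) μ) {f : (Fin n → ℝ) → ℝ}
    (hf : ∀ x y, |f x - f y| ≤ ∑ i, |x i - y i|) :
    Integrable f (Measure.pi fun _ : Fin n => μ) := by
  have hi : Integrable (fun x : Fin n → ℝ => |f 0| + ∑ i, |x i|)
      (Measure.pi fun _ : Fin n => μ) := by
    refine (integrable_const _).add (integrable_finsetSum _ fun i _ => ?_)
    exact (((measurePreserving_eval (fun _ : Fin n => μ) i).integrable_comp
      hμ.aestronglyMeasurable).2 hμ).abs
  refine hi.mono' (continuous_of_abs_sub_le_sum hf).aestronglyMeasurable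
    (Filter.Eventually.of_forall fun x => ?_)
  have := hf x 0
  simp only [Pi.zero_apply, sub_zero] at this
  rw [Real.norm_eq_abs]
  have h2 := abs_sub_abs_le_abs_sub (f x) (f 0)
  linarith

theorem measurePreserving_cons (n : ℕ) (μ : Measure ℝ) [IsProbabilityMeasure μ] :
    MeasurePreserving (fun p : (Fin n → ℝ) × ℝ => (Fin.cons p.2 p.1 : Fin (n + 1) → ℝ))
      ((Measure.pi fun _ : Fin n => μ).prod μ) (Measure.pi fun _ : Fin (n + 1) => μ) := by
  have h := (measurePreserving_piFinSuccAbove (fun _ : Fin (n + 1) => μ) 0).symm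
  have := h.comp (Measure.measurePreserving_swap (μ := Measure.pi fun _ : Fin n => μ) (ν := μ))
  convert this using 1
  funext p
  simp [MeasurableEquiv.piFinSuccAbove, Fin.insertNthEquiv]

/-- Functions that are `1`-Lipschitz for the `ℓ¹` norm of independent samples have sub-Gaussian
moment generating functions in a neighbourhood of zero. -/
theorem IsOneSubGaussian.lintegral_exp_pi_le {μ : Measure ℝ} [IsProbabilityMeasure μ]
    (h : IsOneSubGaussian μ) (h0 : ∀ᵐ x ∂μ, 0 ≤ x) {s : ℝ} (hs : s ^ 2 ≤ 1 / 2) :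
    ∀ (n : ℕ) (f : (Fin n → ℝ) → ℝ), (∀ x y, |f x - f y| ≤ ∑ i, |x i - y i|) →
      ∫⁻ x, ENNReal.ofReal (Real.exp (s * (f x - ∫ y, f y ∂(Measure.pi fun _ => μ))))
        ∂(Measure.pi fun _ => μ) ≤ ENNReal.ofReal (Real.exp (8 * s ^ 2)) ^ n := by
  intro n
  induction n with
  | zero =>
    intro f hf
    have : ∀ x, f x = f 0 := fun x => by rw [Subsingleton.elim x 0]
    simp [this]
  | succ n ih =>
    intro f hf
    have hcont := continuous_of_abs_sub_le_sum hf
    have hint := integrable_of_abs_sub_le_sum h.integrable_id hf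
    have hmp := measurePreserving_cons n μ
    have hf1 : ∀ x' a b, |f (Fin.cons a x') - f (Fin.cons b x')| ≤ |a - b| := by
      intro x' a b
      refine (hf _ _).trans_eq ?_
      rw [Fin.sum_univ_succ]
      simp
    have hf2 : ∀ a x' y', |f (Fin.cons a x') - f (Fin.cons a y')| ≤ ∑ i, |x' i - y' i| := by
      intro a x' y'
      refine (hf _ _).trans_eq ?_
      rw [Fin.sum_univ_succ]
      simp
    have hm1 : ∀ x', Continuous fun a : ℝ => f (Fin.cons a x') := fun x' =>
      hcont.comp (by fun_prop)
    have hint1 : ∀ x', Integrable (fun a => f (Fin.cons a x')) μ := by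
      intro x'
      refine ((integrable_const |f (Fin.cons 0 x')|).add h.integrable_id.abs).mono'
        (hm1 x').aestronglyMeasurable (Filter.Eventually.of_forall fun a => ?_)
      have h1 := hf1 x' a 0
      have h2 := abs_sub_abs_le_abs_sub (f (Fin.cons a x')) (f (Fin.cons 0 x'))
      simp only [sub_zero] at h1
      simp only [Real.norm_eq_abs, Pi.add_apply]
      linarith
    set g : (Fin n → ℝ) → ℝ := fun x' => ∫ a, f (Fin.cons a x') ∂μ with hg
    have hgL : ∀ x y, |g x - g y| ≤ ∑ i, |x i - y i| := by
      intro x y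
      rw [hg, ← integral_sub (hint1 x) (hint1 y)]
      have := norm_integral_le_of_norm_le_const (μ := μ) (C := ∑ i, |x i - y i|)
        (f := fun a => f (Fin.cons a x) - f (Fin.cons a y))
        (Filter.Eventually.of_forall fun a => hf2 a x y)
      rwa [probReal_univ, mul_one] at this
    have hgi : ∫ y, f y ∂(Measure.pi fun _ : Fin (n + 1) => μ) =
        ∫ y, g y ∂(Measure.pi fun _ : Fin n => μ) := by
      rw [← hmp.map_eq, integral_map hmp.aemeasurable hcont.aestronglyMeasurable, integral_prod]
      exact (hmp.integrable_comp hcont.aestronglyMeasurable).2 hint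
    have hgc := (continuous_of_abs_sub_le_sum hgL).measurable
    have hfm := hcont.measurable
    rw [← hmp.lintegral_comp (by fun_prop), lintegral_prod _ (by
      have := hmp.measurable
      fun_prop)]
    set E := ∫ y, g y ∂(Measure.pi fun _ : Fin n => μ) with hE
    rw [hgi]
    calc _ ≤ ∫⁻ x', ENNReal.ofReal (Real.exp (s * (g x' - E))) *
            ENNReal.ofReal (Real.exp (8 * s ^ 2)) ∂(Measure.pi fun _ : Fin n => μ) := by
          refine lintegral_mono fun x' => ?_
          refine le_trans (le_of_eq ?_) (mul_le_mul_right (h.lintegral_exp_sub_integral_le h0 hs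
            (hf1 x') (hm1 x').measurable (hint1 x')) _)
          have := (hm1 x').measurable
          rw [← lintegral_const_mul _ (by fun_prop)]
          refine lintegral_congr fun a => ?_
          rw [← ENNReal.ofReal_mul (Real.exp_pos _).le, ← Real.exp_add]
          simp only [hg]
          ring_nf
      _ ≤ _ := by
          rw [lintegral_mul_const _ (by fun_prop), pow_succ]
          exact mul_le_mul_left (ih g hgL) _

theorem IsOneSubGaussian.measure_pi_ge_le {μ : Measure ℝ} [IsProbabilityMeasure μ]
    (h : IsOneSubGaussian μ) (h0 : ∀ᵐ x ∂μ, 0 ≤ x) {s : ℝ} (hs0 : 0 ≤ s) (hs : s ^ 2 ≤ 1 / 2)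
    {n : ℕ} {f : (Fin n → ℝ) → ℝ} (hf : ∀ x y, |f x - f y| ≤ ∑ i, |x i - y i|) (r : ℝ) :
    (Measure.pi fun _ : Fin n => μ) {x | r ≤ f x - ∫ y, f y ∂(Measure.pi fun _ => μ)} ≤
      ENNReal.ofReal (Real.exp (8 * s ^ 2 * n - s * r)) := by
  have key := h.lintegral_exp_pi_le h0 hs n f hf
  have hfm := (continuous_of_abs_sub_le_sum hf).measurable
  set E := ∫ y, f y ∂(Measure.pi fun _ : Fin n => μ)
  have hmk := mul_meas_ge_le_lintegral (μ := Measure.pi fun _ : Fin n => μ)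
    (f := fun x => ENNReal.ofReal (Real.exp (s * (f x - E)))) (by fun_prop)
    (ENNReal.ofReal (Real.exp (s * r)))
  have hsub : (Measure.pi fun _ : Fin n => μ) {x | r ≤ f x - E} ≤
      (Measure.pi fun _ : Fin n => μ) {x | ENNReal.ofReal (Real.exp (s * r)) ≤
        ENNReal.ofReal (Real.exp (s * (f x - E)))} := by
    refine measure_mono fun x hx => ENNReal.ofReal_le_ofReal (Real.exp_le_exp.2 ?_)
    exact mul_le_mul_of_nonneg_left hx hs0
  have hfinal : ENNReal.ofReal (Real.exp (s * r)) *
      (Measure.pi fun _ : Fin n => μ) {x | r ≤ f x - E} ≤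
      ENNReal.ofReal (Real.exp (s * r)) * ENNReal.ofReal (Real.exp (8 * s ^ 2 * n - s * r)) := by
    refine (mul_le_mul_right hsub _).trans (hmk.trans (key.trans_eq ?_))
    rw [← ENNReal.ofReal_mul (Real.exp_pos _).le, ← Real.exp_add,
      ← ENNReal.ofReal_pow (Real.exp_pos _).le, ← Real.exp_nat_mul]
    ring_nf
  exact (ENNReal.mul_le_mul_iff_right (by simpa using Real.exp_pos _) ENNReal.ofReal_ne_top).1 hfinal

/-- The distribution function of the point mass at `a`. -/
noncomputable def step (a t : ℝ) : ℝ := (Set.Ici a).indicator 1 t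

theorem step_eq_ite (a t : ℝ) : step a t = if a ≤ t then 1 else 0 := by
  simp [step, Set.indicator]

theorem step_mem_Icc (a t : ℝ) : step a t ∈ Set.Icc (0 : ℝ) 1 := by
  rw [step_eq_ite]
  split_ifs <;> simp

theorem measurable_step : Measurable fun z : ℝ × ℝ => step z.1 z.2 := by
  simp_rw [step_eq_ite]
  exact Measurable.ite (measurableSet_le measurable_fst measurable_snd) measurable_const
    measurable_const

theorem measurable_step_comp {α : Type*} [MeasurableSpace α] {f g : α → ℝ} (hf : Measurable f)
    (hg : Measurable g) : Measurable fun x => step (f x) (g x) :=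
  measurable_step.comp (hf.prodMk hg)

theorem integrable_step_sub (a b : ℝ) : Integrable fun t => step a t - step b t := by
  refine ⟨((measurable_step_comp measurable_const measurable_id).sub
    (measurable_step_comp measurable_const measurable_id)).aestronglyMeasurable, ?_⟩
  rw [hasFiniteIntegral_iff_norm]
  exact (lintegral_abs_step_sub_step a b).trans_lt (edist_lt_top a b)

theorem integral_abs_step_sub (a b : ℝ) : ∫ t, |step a t - step b t| = |a - b| := by
  rw [integral_eq_lintegral_of_nonneg_ae (Filter.Eventually.of_forall fun _ => abs_nonneg _)
    (integrable_step_sub a b).abs.aestronglyMeasurable]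
  exact (congrArg _ (lintegral_abs_step_sub_step a b)).trans (by
    rw [edist_dist, ENNReal.toReal_ofReal dist_nonneg, Real.dist_eq])

theorem cdf_dirac (a t : ℝ) : cdf (Measure.dirac a) t = step a t := by
  rw [cdf_eq_real, step_eq_ite, measureReal_def, Measure.dirac_apply' _ measurableSet_Iic]
  by_cases h : a ≤ t <;> simp [h]

theorem integral_step (μ : Measure ℝ) [IsProbabilityMeasure μ] (t : ℝ) :
    ∫ x, step x t ∂μ = cdf μ t := by
  have : (fun x => step x t) = (Set.Iic t).indicator 1 := by
    ext x
    rw [step_eq_ite]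
    simp [Set.indicator]
  rw [this, integral_indicator_one measurableSet_Iic, cdf_eq_real]

theorem IsOneSubGaussian.one_sub_cdf_le {μ : Measure ℝ} [IsProbabilityMeasure μ]
    (h : IsOneSubGaussian μ) {t : ℝ} (ht : 0 ≤ t) :
    1 - cdf μ t ≤ 2 * Real.exp (-t ^ 2 / 2) := by
  rw [cdf_eq_real, ← probReal_compl_eq_one_sub measurableSet_Iic]
  refine (measureReal_mono ?_).trans (h t ht)
  intro x hx
  have hx : t < x := by simpa using hx
  exact hx.trans_le (le_abs_self x)

theorem cdf_eq_zero_of_neg {μ : Measure ℝ} [IsProbabilityMeasure μ] (h0 : ∀ᵐ x ∂μ, 0 ≤ x) {t : ℝ}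
    (ht : t < 0) : cdf μ t = 0 := by
  rw [cdf_eq_real, measureReal_def, measure_eq_zero_iff_ae_notMem.2, ENNReal.toReal_zero]
  exact h0.mono fun x hx hxt => absurd (hx.trans hxt) (not_le.2 ht)

theorem sqrt_two_pi_le : √(2 * Real.pi) ≤ 3 := by
  rw [Real.sqrt_le_left (by norm_num)]
  linarith [Real.pi_lt_d2]

theorem lintegral_gaussian_tail_le {c b : ℝ} (hc : 0 ≤ c) (hb : 0 < b) (g : ℝ → ℝ)
    (hneg : ∀ t < 0, g t ≤ 0) (hg : ∀ t, 0 ≤ t → g t ≤ c * Real.exp (-b * t ^ 2)) :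
    ∫⁻ t, ENNReal.ofReal (g t) ≤ ENNReal.ofReal (c * (√(Real.pi / b) / 2)) := by
  calc ∫⁻ t, ENNReal.ofReal (g t)
      ≤ ∫⁻ t, (Set.Ici 0).indicator (fun t => ENNReal.ofReal (c * Real.exp (-b * t ^ 2))) t := by
        refine lintegral_mono fun t => ?_
        by_cases ht : 0 ≤ t
        · simpa [Set.indicator, ht] using ENNReal.ofReal_le_ofReal (hg t ht)
        · simpa [Set.indicator, ht] using hneg t (not_le.1 ht)
    _ = ∫⁻ t in Set.Ioi 0, ENNReal.ofReal (c * Real.exp (-b * t ^ 2)) := by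
        rw [lintegral_indicator measurableSet_Ici, setLIntegral_congr Ioi_ae_eq_Ici]
    _ = _ := by
        rw [← ofReal_integral_eq_lintegral_ofReal, integral_const_mul, integral_gaussian_Ioi]
        · exact ((integrable_exp_neg_mul_sq hb).const_mul c).integrableOn
        · exact Filter.Eventually.of_forall fun t => mul_nonneg hc (Real.exp_pos _).le

theorem IsOneSubGaussian.cdfDist_dirac_zero_le {μ : Measure ℝ} [IsProbabilityMeasure μ]
    (h : IsOneSubGaussian μ) (h0 : ∀ᵐ x ∂μ, 0 ≤ x) :
    cdfDist μ (Measure.dirac 0) ≤ ENNReal.ofReal 3 := by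
  refine (lintegral_gaussian_tail_le (c := 2) (b := 1 / 2) (by norm_num) (by norm_num) _
    (fun t ht => ?_) (fun t ht => ?_)).trans (ENNReal.ofReal_le_ofReal ?_)
  · rw [cdf_eq_zero_of_neg h0 ht, cdf_dirac, step_eq_ite, if_neg (not_le.2 ht)]
    simp
  · rw [cdf_dirac, step_eq_ite, if_pos ht, abs_sub_comm, abs_of_nonneg
      (sub_nonneg.2 (cdf_le_one μ t))]
    convert h.one_sub_cdf_le ht using 3
    ring
  · convert sqrt_two_pi_le using 1
    rw [show Real.pi / (1 / 2) = 2 * Real.pi by ring]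
    ring

theorem IsOneSubGaussian.integrable_step_sub_cdf {μ : Measure ℝ} [IsProbabilityMeasure μ]
    (h : IsOneSubGaussian μ) (h0 : ∀ᵐ x ∂μ, 0 ≤ x) (a : ℝ) :
    Integrable fun t => step a t - cdf μ t := by
  have h1 : Integrable fun t => step 0 t - cdf μ t := by
    refine ⟨((measurable_step_comp measurable_const measurable_id).sub
      (measurable_cdf μ)).aestronglyMeasurable, ?_⟩
    rw [hasFiniteIntegral_iff_norm]
    refine lt_of_le_of_lt ?_ (h.cdfDist_dirac_zero_le h0 |>.trans_lt ENNReal.ofReal_lt_top)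
    refine lintegral_mono fun t => ?_
    rw [cdf_dirac, Real.norm_eq_abs, abs_sub_comm]
  refine ((integrable_step_sub a 0).add h1).congr (Filter.Eventually.of_forall fun t => ?_)
  simp

/-- The sample size times the `L¹` distance between the empirical distribution function and the
distribution function of `μ`. -/
noncomputable def sampleDist (μ : Measure ℝ) {n : ℕ} (x : Fin n → ℝ) : ℝ :=
  ∫ t, |∑ j, (step (x j) t - cdf μ t)|

section SampleDist

variable {μ : Measure ℝ} [IsProbabilityMeasure μ] {n : ℕ}

theorem IsOneSubGaussian.integrable_sum_step (h : IsOneSubGaussian μ) (h0 : ∀ᵐ x ∂μ, 0 ≤ x)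
    (x : Fin n → ℝ) : Integrable fun t => ∑ j, (step (x j) t - cdf μ t) :=
  integrable_finsetSum _ fun j _ => h.integrable_step_sub_cdf h0 (x j)

theorem IsOneSubGaussian.abs_sampleDist_sub_le (h : IsOneSubGaussian μ) (h0 : ∀ᵐ x ∂μ, 0 ≤ x)
    (x y : Fin n → ℝ) : |sampleDist μ x - sampleDist μ y| ≤ ∑ j, |x j - y j| := by
  rw [sampleDist, sampleDist, ← integral_sub (h.integrable_sum_step h0 x).abs
    (h.integrable_sum_step h0 y).abs]
  have hi : ∀ j, Integrable fun t => |step (x j) t - step (y j) t| := fun j =>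
    (integrable_step_sub _ _).abs
  calc _ ≤ ∫ t, |(|∑ j, (step (x j) t - cdf μ t)| - |∑ j, (step (y j) t - cdf μ t)|)| :=
        abs_integral_le_integral_abs
    _ ≤ ∫ t, ∑ j, |step (x j) t - step (y j) t| := by
        refine integral_mono_of_nonneg (Filter.Eventually.of_forall fun _ => abs_nonneg _)
          (integrable_finsetSum _ fun j _ => hi j) (Filter.Eventually.of_forall fun t => ?_)
        refine (abs_abs_sub_abs_le_abs_sub _ _).trans ?_
        rw [← Finset.sum_sub_distrib]
        simp_rw [sub_sub_sub_cancel_right]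
        exact Finset.abs_sum_le_sum_abs _ _
    _ = _ := by
        rw [integral_finsetSum _ fun j _ => hi j]
        simp_rw [integral_abs_step_sub]

theorem variance_step_le (t : ℝ) :
    Var[fun x => step x t - cdf μ t; μ] ≤ (1 - cdf μ t) * cdf μ t := by
  have hm : Measurable fun x => step x t - cdf μ t :=
    (measurable_step_comp measurable_id measurable_const).sub measurable_const
  have := variance_le_sub_mul_sub (μ := μ) (a := -cdf μ t) (b := 1 - cdf μ t)
    (X := fun x => step x t - cdf μ t) (Filter.Eventually.of_forall fun x => by
      have := step_mem_Icc x t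
      constructor <;> linarith [this.1, this.2]) hm.aemeasurable
  have hi : Integrable (fun x => step x t) μ := Integrable.of_bound
    (measurable_step_comp measurable_id measurable_const).aestronglyMeasurable 1
    (Filter.Eventually.of_forall fun x => by
      rw [Real.norm_eq_abs, abs_of_nonneg (step_mem_Icc x t).1]; exact (step_mem_Icc x t).2)
  have hE : ∫ x, (step x t - cdf μ t) ∂μ = 0 := by
    rw [integral_sub hi (integrable_const _), integral_step]
    simp
  rwa [hE, sub_zero, zero_sub, neg_neg] at this

theorem lintegral_abs_le_sqrt_variance {α : Type*} [MeasurableSpace α] {ν : Measure α}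
    [IsProbabilityMeasure ν] {G : α → ℝ} (hG : MemLp G 2 ν) (hE : ∫ x, G x ∂ν = 0) :
    ∫⁻ x, ENNReal.ofReal |G x| ∂ν ≤ ENNReal.ofReal (√(Var[G; ν])) := by
  rw [← ofReal_integral_eq_lintegral_ofReal (hG.integrable one_le_two).abs
    (Filter.Eventually.of_forall fun _ => abs_nonneg _)]
  refine ENNReal.ofReal_le_ofReal (Real.le_sqrt_of_sq_le ?_)
  have h1 := variance_eq_sub hG
  have h2 := variance_eq_sub hG.abs
  have h3 := variance_nonneg |G| ν
  have h4 : ∫ x, (|G| ^ 2) x ∂ν = ∫ x, (G ^ 2) x ∂ν := by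
    refine integral_congr_ae (Filter.Eventually.of_forall fun x => ?_)
    simp
  rw [h4] at h2
  simp only [Pi.abs_apply] at h2
  rw [hE] at h1
  linarith

theorem lintegral_abs_sum_step_le (t : ℝ) :
    ∫⁻ x, ENNReal.ofReal |∑ j, (step (x j) t - cdf μ t)| ∂(Measure.pi fun _ : Fin n => μ) ≤
      ENNReal.ofReal √(n * ((1 - cdf μ t) * cdf μ t)) := by
  have hm : Measurable fun x => step x t - cdf μ t :=
    (measurable_step_comp measurable_id measurable_const).sub measurable_const
  have hb : ∀ x, ‖step x t - cdf μ t‖ ≤ 1 := fun x => by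
    rw [Real.norm_eq_abs, abs_le]
    have := step_mem_Icc x t
    constructor <;> linarith [this.1, this.2, cdf_nonneg μ t, cdf_le_one μ t]
  have hLp : MemLp (fun x => step x t - cdf μ t) 2 μ :=
    MemLp.of_bound hm.aestronglyMeasurable 1 (Filter.Eventually.of_forall hb)
  have hLpj : ∀ j : Fin n, MemLp (fun x : Fin n → ℝ => step (x j) t - cdf μ t) 2
      (Measure.pi fun _ : Fin n => μ) := fun j =>
    hLp.comp_measurePreserving (measurePreserving_eval (fun _ : Fin n => μ) j)
  have hvar := variance_sum_pi (μ := fun _ : Fin n => μ)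
    (X := fun _ x => step x t - cdf μ t) fun _ => hLp
  have hfun : (∑ j : Fin n, fun x : Fin n → ℝ => step (x j) t - cdf μ t) =
      fun x => ∑ j, (step (x j) t - cdf μ t) := by
    ext x
    simp
  rw [hfun] at hvar
  have hE : ∫ x, ∑ j, (step (x j) t - cdf μ t) ∂(Measure.pi fun _ : Fin n => μ) = 0 := by
    rw [integral_finsetSum _ fun j _ => (hLpj j).integrable one_le_two]
    refine Finset.sum_eq_zero fun j _ => ?_
    rw [integral_comp_eval (μ := fun _ : Fin n => μ) (f := fun x => step x t - cdf μ t)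
      hm.aestronglyMeasurable, integral_sub _ (integrable_const _), integral_step]
    · simp
    · exact ((hLp.integrable one_le_two).add (integrable_const (cdf μ t))).congr
        (Filter.Eventually.of_forall fun x => by simp)
  refine (lintegral_abs_le_sqrt_variance (memLp_finsetSum _ fun j _ => hLpj j) hE).trans
    (ENNReal.ofReal_le_ofReal (Real.sqrt_le_sqrt ?_))
  rw [hvar, Finset.sum_const, Finset.card_univ, Fintype.card_fin, nsmul_eq_mul]
  exact mul_le_mul_of_nonneg_left (variance_step_le t) (Nat.cast_nonneg n)

theorem IsOneSubGaussian.integral_sampleDist_le (h : IsOneSubGaussian μ)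
    (h0 : ∀ᵐ x ∂μ, 0 ≤ x) :
    ∫ x, sampleDist μ x ∂(Measure.pi fun _ : Fin n => μ) ≤ 3 * √n := by
  have hint := integrable_of_abs_sub_le_sum h.integrable_id
    (h.abs_sampleDist_sub_le (n := n) h0)
  have hnn : ∀ x : Fin n → ℝ, 0 ≤ sampleDist μ x := fun x => integral_nonneg fun _ => abs_nonneg _
  have hmeas : Measurable fun z : (Fin n → ℝ) × ℝ => ∑ j, (step (z.1 j) z.2 - cdf μ z.2) :=
    Finset.measurable_sum _ fun j _ => (measurable_step_comp (by fun_prop) measurable_snd).sub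
      ((measurable_cdf μ).comp measurable_snd)
  rw [← ENNReal.ofReal_le_ofReal_iff (by positivity),
    ofReal_integral_eq_lintegral_ofReal hint (Filter.Eventually.of_forall hnn)]
  calc ∫⁻ x, ENNReal.ofReal (sampleDist μ x) ∂(Measure.pi fun _ : Fin n => μ)
      = ∫⁻ x, ∫⁻ t, ENNReal.ofReal |∑ j, (step (x j) t - cdf μ t)|
          ∂volume ∂(Measure.pi fun _ : Fin n => μ) := by
        refine lintegral_congr fun x => ?_
        exact ofReal_integral_eq_lintegral_ofReal (h.integrable_sum_step h0 x).abs
          (Filter.Eventually.of_forall fun _ => abs_nonneg _)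
    _ = ∫⁻ t, ∫⁻ x, ENNReal.ofReal |∑ j, (step (x j) t - cdf μ t)|
          ∂(Measure.pi fun _ : Fin n => μ) ∂volume :=
        lintegral_lintegral_swap hmeas.abs.ennreal_ofReal.aemeasurable
    _ ≤ ∫⁻ t, ENNReal.ofReal √(n * ((1 - cdf μ t) * cdf μ t)) :=
        lintegral_mono fun t => lintegral_abs_sum_step_le t
    _ ≤ ENNReal.ofReal (√n * √2 * (√(Real.pi / (1 / 4)) / 2)) := by
        refine lintegral_gaussian_tail_le (by positivity) (by norm_num) _ (fun t ht => ?_)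
          (fun t ht => ?_)
        · rw [cdf_eq_zero_of_neg h0 ht]
          simp
        · refine Real.sqrt_le_iff.2 ⟨by positivity, ?_⟩
          rw [mul_pow, mul_pow, Real.sq_sqrt (by positivity), Real.sq_sqrt (by norm_num),
            ← Real.exp_nat_mul, mul_assoc]
          refine mul_le_mul_of_nonneg_left ?_ (by positivity)
          calc (1 - cdf μ t) * cdf μ t ≤ 1 - cdf μ t :=
                mul_le_of_le_one_right (sub_nonneg.2 (cdf_le_one μ t)) (cdf_le_one μ t)
            _ ≤ _ := h.one_sub_cdf_le ht
            _ = _ := by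
              congr 2
              push_cast
              ring
    _ ≤ _ := by
        refine ENNReal.ofReal_le_ofReal ?_
        have : √(Real.pi / (1 / 4)) = 2 * √Real.pi := by
          rw [show Real.pi / (1 / 4) = 2 ^ 2 * Real.pi by ring, Real.sqrt_mul (by norm_num),
            Real.sqrt_sq (by norm_num)]
        have h2 := sqrt_two_pi_le
        rw [Real.sqrt_mul (by norm_num)] at h2
        rw [this]
        nlinarith [Real.sqrt_nonneg (n : ℝ)]

/-- Concentration of the empirical distribution in the Wasserstein distance. -/
theorem IsOneSubGaussian.measure_sampleDist_ge_le (h : IsOneSubGaussian μ)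
    (h0 : ∀ᵐ x ∂μ, 0 ≤ x) {δ : ℝ} (hδ0 : 0 ≤ δ) (hδ : δ ≤ 6) (hn : 6 ≤ δ * √n) :
    (Measure.pi fun _ : Fin n => μ) {x | n * δ ≤ sampleDist μ x} ≤
      ENNReal.ofReal (Real.exp (-(n * δ ^ 2) / 128)) := by
  have hE := h.integral_sampleDist_le (n := n) h0
  have hnn : √(n : ℝ) * √n = n := Real.mul_self_sqrt (Nat.cast_nonneg n)
  have hE' : ∫ x, sampleDist μ x ∂(Measure.pi fun _ : Fin n => μ) ≤ n * δ / 2 := by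
    nlinarith [Real.sqrt_nonneg (n : ℝ)]
  have key := h.measure_pi_ge_le h0 (s := δ / 32) (by positivity) (by nlinarith)
    (h.abs_sampleDist_sub_le (n := n) h0) (n * δ / 2)
  refine (measure_mono fun x hx => ?_).trans (key.trans_eq ?_)
  · have hx : n * δ ≤ sampleDist μ x := hx
    show n * δ / 2 ≤ _
    linarith
  · congr 2
    ring

/-- The empirical distribution of a sample. -/
noncomputable def sampleMeasure (x : Fin n → ℝ) : Measure ℝ :=
  (n : ℝ≥0∞)⁻¹ • ∑ j, Measure.dirac (x j)

theorem isProbabilityMeasure_sampleMeasure (hn : 0 < n) (x : Fin n → ℝ) :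
    IsProbabilityMeasure (sampleMeasure x) := by
  constructor
  simp only [sampleMeasure, Measure.smul_apply, Measure.coe_finsetSum, Finset.sum_apply,
    measure_univ, Finset.sum_const, Finset.card_univ, Fintype.card_fin, nsmul_eq_mul, mul_one,
    smul_eq_mul]
  exact ENNReal.inv_mul_cancel (by exact_mod_cast hn.ne') (ENNReal.natCast_ne_top n)

theorem cdf_sampleMeasure (hn : 0 < n) (x : Fin n → ℝ) (t : ℝ) :
    cdf (sampleMeasure x) t = (n : ℝ)⁻¹ * ∑ j, step (x j) t := by
  have := isProbabilityMeasure_sampleMeasure hn x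
  rw [cdf_eq_real, measureReal_def]
  simp only [sampleMeasure, Measure.smul_apply, Measure.coe_finsetSum, Finset.sum_apply,
    smul_eq_mul, ENNReal.toReal_mul, ENNReal.toReal_inv, ENNReal.toReal_natCast]
  rw [ENNReal.toReal_sum fun _ _ => measure_ne_top _ _]
  simp_rw [← cdf_dirac, cdf_eq_real, measureReal_def]

theorem IsOneSubGaussian.cdfDist_sampleMeasure (h : IsOneSubGaussian μ)
    (h0 : ∀ᵐ x ∂μ, 0 ≤ x) (hn : 0 < n) (x : Fin n → ℝ) :
    cdfDist μ (sampleMeasure x) = ENNReal.ofReal ((n : ℝ)⁻¹ * sampleDist μ x) := by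
  have hn' : (n : ℝ) ≠ 0 := by exact_mod_cast hn.ne'
  rw [sampleDist, ← integral_const_mul, ofReal_integral_eq_lintegral_ofReal
    ((h.integrable_sum_step h0 x).abs.const_mul _)
    (Filter.Eventually.of_forall fun _ => by positivity)]
  refine lintegral_congr fun t => ?_
  rw [cdf_sampleMeasure hn, abs_sub_comm]
  congr 1
  have : (n : ℝ)⁻¹ * ∑ j, step (x j) t - cdf μ t =
      (n : ℝ)⁻¹ * ∑ j, (step (x j) t - cdf μ t) := by
    rw [Finset.sum_sub_distrib]
    simp
    field_simp
  rw [this, abs_mul, abs_of_nonneg (by positivity : (0 : ℝ) ≤ (n : ℝ)⁻¹)]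

end SampleDist

section Policy

variable {K : ℕ}

theorem sum_filter_snoc {M : Type*} [AddCommMonoid M] {t : ℕ} (H : History K t) (p : Fin K × ℝ)
    (i : Fin K) (g : ℝ → M) :
    ∑ s ∈ Finset.univ.filter (fun s => (Fin.snoc (α := fun _ => Fin K × ℝ) H p s).1 = i),
        g (Fin.snoc (α := fun _ => Fin K × ℝ) H p s).2 =
      (∑ s ∈ Finset.univ.filter (fun s => (H s).1 = i), g (H s).2) +
        if p.1 = i then g p.2 else 0 := by
  rw [Finset.sum_filter, Finset.sum_filter, Fin.sum_univ_castSucc]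
  simp

theorem pulls_snoc {t : ℕ} (H : History K t) (p : Fin K × ℝ) (i : Fin K) :
    pulls (Fin.snoc (α := fun _ => Fin K × ℝ) H p) i = pulls H i + if p.1 = i then 1 else 0 := by
  simp only [pulls, Finset.card_eq_sum_ones]
  exact sum_filter_snoc H p i fun _ => 1

theorem sum_pulls {t : ℕ} (H : History K t) : ∑ i, pulls H i = t := by
  simp only [pulls]
  rw [← Finset.card_eq_sum_card_fiberwise (fun s _ => Finset.mem_coe.2 (Finset.mem_univ _))]
  simp

theorem pulls_div_mem_stdSimplex {T : ℕ} (hT : 0 < T) (H : History K T) :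
    (fun i => (pulls H i : ℝ) / T) ∈ stdSimplex ℝ (Fin K) := by
  refine ⟨fun i => by positivity, ?_⟩
  have : (T : ℝ) ≠ 0 := by exact_mod_cast hT.ne'
  rw [← Finset.sum_div, ← Nat.cast_sum, sum_pulls, div_self this]

namespace Policy

variable (π : Policy K) (y : Fin K × ℕ → ℝ)

theorem history_succ (t : ℕ) : π.history y (t + 1) =
    Fin.snoc (α := fun _ => Fin K × ℝ) (π.history y t) (π.choose t (π.history y t),
      y (π.choose t (π.history y t), pulls (π.history y t) (π.choose t (π.history y t)))) := rfl

theorem pulls_history_succ (t : ℕ) (i : Fin K) : pulls (π.history y (t + 1)) i =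
    pulls (π.history y t) i + if π.choose t (π.history y t) = i then 1 else 0 := by
  rw [history_succ, pulls_snoc]

theorem history_castLE {t t' : ℕ} (h : t ≤ t') :
    (fun s => π.history y t' (Fin.castLE h s)) = π.history y t := by
  induction t', h using Nat.le_induction with
  | base => rfl
  | succ n hn ih =>
    rw [← ih]
    funext s
    rw [history_succ, show Fin.castLE (Nat.le_succ_of_le hn) s =
      Fin.castSucc (Fin.castLE hn s) from rfl, Fin.snoc_castSucc]

theorem history_arm {t : ℕ} (s : Fin t) :
    (π.history y t s).1 = π.choose s (π.history y s) := by
  have := congrFun (π.history_castLE y (Nat.succ_le_of_lt s.2)) (Fin.last s)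
  rw [show Fin.castLE (Nat.succ_le_of_lt s.2) (Fin.last s) = s from rfl, history_succ,
    Fin.snoc_last] at this
  rw [this]

theorem sum_rewards_history {M : Type*} [AddCommMonoid M] (g : ℝ → M) (i : Fin K) (t : ℕ) :
    ∑ s ∈ Finset.univ.filter (fun s => (π.history y t s).1 = i), g (π.history y t s).2 =
      ∑ j ∈ Finset.range (pulls (π.history y t) i), g (y (i, j)) := by
  induction t with
  | zero => simp [pulls]
  | succ t ih =>
    rw [pulls_history_succ]
    rw [history_succ, sum_filter_snoc, ih]
    split_ifs with h
    · obtain rfl : π.choose t (π.history y t) = i := h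
      rw [Finset.sum_range_succ]
    · simp

theorem empirical_history (i : Fin K) (t : ℕ) : empirical (π.history y t) i =
    sampleMeasure fun j : Fin (pulls (π.history y t) i) => y (i, j) := by
  rw [empirical, sampleMeasure, sum_rewards_history, Finset.sum_range]

theorem measurable_history (t : ℕ) : Measurable fun y => π.history y t := by
  induction t with
  | zero => exact measurable_const
  | succ t ih =>
    have hc : Measurable fun y => π.choose t (π.history y t) := (π.measurable_choose t).comp ih
    have hp : ∀ i, Measurable fun H : History K t => pulls H i := by
      intro i
      have : (fun H : History K t => pulls H i) = fun H => ∑ s, if (H s).1 = i then 1 else 0 := by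
        ext H
        rw [pulls, Finset.card_filter]
      rw [this]
      refine Finset.measurable_sum _ fun s _ => ?_
      exact (measurable_of_countable fun j : Fin K => if j = i then (1 : ℕ) else 0).comp
        (measurable_fst.comp (measurable_pi_apply s))
    have hp' : Measurable fun z : Fin K × History K t => pulls z.2 z.1 :=
      measurable_from_prod_countable_right fun i => hp i
    have hev : Measurable fun z : (Fin K × ℕ) × (Fin K × ℕ → ℝ) => z.2 z.1 :=
      measurable_from_prod_countable_right fun p => measurable_pi_apply p
    refine measurable_pi_iff.2 fun s => ?_
    induction s using Fin.lastCases with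
    | last =>
      simp only [history_succ, Fin.snoc_last]
      exact hc.prodMk (hev.comp ((hc.prodMk (hp'.comp (hc.prodMk ih))).prodMk measurable_id))
    | cast s =>
      simp only [history_succ, Fin.snoc_castSucc]
      exact (measurable_pi_apply s).comp ih

theorem measurable_comp_pulls_history {β : Type*} [MeasurableSpace β] (t : ℕ)
    (f : (Fin K → ℕ) → β) : Measurable fun y => f (pulls (π.history y t)) := by
  refine (measurable_of_countable f).comp (measurable_pi_iff.2 fun i => ?_)
  have : (fun y => pulls (π.history y t) i) =
      fun y => ∑ s, if (π.history y t s).1 = i then 1 else 0 := by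
    ext y
    rw [pulls, Finset.card_filter]
  rw [this]
  refine Finset.measurable_sum _ fun s _ => ?_
  exact (measurable_of_countable fun j : Fin K => if j = i then (1 : ℕ) else 0).comp
    (measurable_fst.comp ((measurable_pi_apply s).comp (π.measurable_history t)))

end Policy

section Commit

variable (hK : 0 < K) {T m : ℕ} {a : Fin K → ℝ}

theorem commitArm_spec (c : Fin K → ℕ) :
    NeedsSampling T m a c (commitArm hK T m a c) ∨
      (((commitArm hK T m a c : Fin K) : ℕ) + 1 = K ∧ ∀ i, ¬ NeedsSampling T m a c i) := by
  classical
  unfold commitArm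
  split_ifs with h
  · have := Finset.min'_mem _ h
    exact Or.inl (Finset.mem_filter.1 this).2
  · refine Or.inr ⟨by simp only; omega, fun i hi => h ⟨i, ?_⟩⟩
    simpa using hi

theorem commit_invariant (ha : ∀ i, 0 ≤ a i) (c : ℕ → Fin K → ℕ) (t₀ : ℕ) (h₀ : ∀ i, c t₀ i = m)
    (hc : ∀ t, t₀ ≤ t → ∀ i, c (t + 1) i = c t i + if commitArm hK T m a (c t) = i then 1 else 0)
    {t : ℕ} (ht : t₀ ≤ t) :
    (∀ i, m ≤ c t i) ∧ (∀ i : Fin K, (i : ℕ) + 1 < K → (c t i : ℝ) ≤ T * a i + m) ∧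
      ((∀ i : Fin K, (i : ℕ) + 1 = K → c t i ≤ m) ∨
        ∀ i : Fin K, (i : ℕ) + 1 < K → ⌊T * a i⌋₊ ≤ c t i) := by
  induction t, ht using Nat.le_induction with
  | base =>
    refine ⟨fun i => (h₀ i).ge, fun i _ => ?_, Or.inl fun i _ => (h₀ i).le⟩
    rw [h₀ i]
    have := mul_nonneg (Nat.cast_nonneg (α := ℝ) T) (ha i)
    linarith
  | succ t ht ih =>
    obtain ⟨h1, h2, h3⟩ := ih
    have hmono : ∀ i, c t i ≤ c (t + 1) i := fun i => by rw [hc t ht]; omega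
    refine ⟨fun i => (h1 i).trans (hmono i), fun i hi => ?_, ?_⟩
    · rw [hc t ht]
      split_ifs with hci
      · rcases commitArm_spec hK (T := T) (m := m) (a := a) (c t) with hs | hs
        · rw [hci] at hs
          have h4 : ((c t i + 1 : ℕ) : ℝ) ≤ (⌊T * a i⌋₊ : ℝ) := by exact_mod_cast hs.2.2
          have h5 := Nat.floor_le (mul_nonneg (Nat.cast_nonneg (α := ℝ) T) (ha i))
          have h6 := Nat.cast_nonneg (α := ℝ) m
          linarith
        · rw [hci] at hs
          omega
      · simpa using h2 i hi
    · rcases commitArm_spec hK (T := T) (m := m) (a := a) (c t) with hs | hs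
      · refine h3.imp (fun h i hi => ?_) fun h i hi => (h i hi).trans (hmono i)
        rw [hc t ht, if_neg, add_zero]
        · exact h i hi
        · rintro rfl
          have := hs.1
          omega
      · refine Or.inr fun i hi => le_trans ?_ (hmono i)
        have := hs.2 i
        by_contra! hlt
        refine this ⟨hi, ?_, hlt⟩
        have h4 : m < ⌊T * a i⌋₊ := (h1 i).trans_lt hlt
        exact lt_of_lt_of_le (by exact_mod_cast h4)
          (Nat.floor_le (mul_nonneg (Nat.cast_nonneg (α := ℝ) T) (ha i)))

theorem sum_abs_le_of_sum_eq_zero {ι : Type*} (s : Finset ι) (x : ι → ℝ) {b : ℝ} (hb : 0 ≤ b)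
    (hx : ∀ i ∈ s, x i ≤ b) (hsum : ∑ i ∈ s, x i = 0) : ∑ i ∈ s, |x i| ≤ 2 * (s.card * b) := by
  calc ∑ i ∈ s, |x i| = ∑ i ∈ s, (|x i| + x i) := by rw [Finset.sum_add_distrib, hsum, add_zero]
    _ ≤ ∑ i ∈ s, 2 * b := by
        refine Finset.sum_le_sum fun i hi => ?_
        rcases abs_cases (x i) with h | h <;> linarith [hx i hi]
    _ = _ := by rw [Finset.sum_const, nsmul_eq_mul]; ring

theorem commit_sum_abs_le (ha : a ∈ stdSimplex ℝ (Fin K)) (hm : K ≤ m) (c : Fin K → ℕ)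
    (hc : ∑ i, c i = T) (h2 : ∀ i : Fin K, (i : ℕ) + 1 < K → (c i : ℝ) ≤ T * a i + m)
    (h3 : (∀ i : Fin K, (i : ℕ) + 1 = K → c i ≤ m) ∨
        ∀ i : Fin K, (i : ℕ) + 1 < K → ⌊T * a i⌋₊ ≤ c i) :
    ∑ i, |(c i : ℝ) - T * a i| ≤ 2 * (K * m) := by
  have hcR : ∑ i, (c i : ℝ) = T := by exact_mod_cast hc
  have hsum : ∑ i, ((c i : ℝ) - T * a i) = 0 := by
    rw [Finset.sum_sub_distrib, ← Finset.mul_sum, ha.2, hcR]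
    ring
  have := sum_abs_le_of_sum_eq_zero Finset.univ (fun i => (c i : ℝ) - T * a i)
    (Nat.cast_nonneg (α := ℝ) m) (fun i _ => ?_) hsum
  · simpa using this
  rcases (Nat.succ_le_of_lt i.2).lt_or_eq with hi | hi
  · have := h2 i hi
    linarith
  rcases h3 with h3 | h3
  · have h4 : (c i : ℝ) ≤ m := by exact_mod_cast h3 i hi
    have := mul_nonneg (Nat.cast_nonneg (α := ℝ) T) (ha.1 i)
    linarith
  · have h5 : ∑ j ∈ Finset.univ.erase i, ((c j : ℝ) - T * a j) ≥
        ∑ j ∈ Finset.univ.erase i, (-1 : ℝ) := by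
      refine Finset.sum_le_sum fun j hj => ?_
      have hji : (j : ℕ) ≠ i := fun h => (Finset.mem_erase.1 hj).1 (Fin.ext h)
      have h6 : (⌊T * a j⌋₊ : ℝ) ≤ c j := by
        exact_mod_cast h3 j (by have := j.2; simp only [Nat.succ_eq_add_one] at hi; omega)
      have h7 := Nat.lt_floor_add_one (T * a j : ℝ)
      linarith
    rw [Finset.sum_const, Finset.card_erase_of_mem (Finset.mem_univ i), Finset.card_univ,
      Fintype.card_fin, nsmul_eq_mul] at h5
    have h8 := Finset.add_sum_erase Finset.univ (fun j => (c j : ℝ) - T * a j) (Finset.mem_univ i)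
    have h9 : ((K - 1 : ℕ) : ℝ) ≤ m := by exact_mod_cast (Nat.sub_le K 1).trans hm
    linarith

end Commit

/-- After exploration, an explore-then-commit policy whose estimate is `a` follows the commit
rule for `a`. -/
theorem IsETCMixture.pulls_spec {hK : 0 < K} {h : ℝ → ℝ} {ε : ℝ} {T m : ℕ} {π : Policy K}
    (hπ : IsETCMixture hK h ε T m π) (hT : K * m ≤ T) (y : Fin K × ℕ → ℝ) :
    ∃ a : Fin K → ℝ,
      IsArgmax h (fun i => sampleMeasure fun j : Fin m => y (i, j)) (discreteSimplex K ε) a ∧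
      (∀ i : Fin K, (i : ℕ) + 1 < K → (pulls (π.history y T) i : ℝ) ≤ T * a i + m) ∧
      ((∀ i : Fin K, (i : ℕ) + 1 = K → pulls (π.history y T) i ≤ m) ∨
        ∀ i : Fin K, (i : ℕ) + 1 < K → ⌊T * a i⌋₊ ≤ pulls (π.history y T) i) := by
  obtain ⟨sched, est, hsched, hest, hexp, hcom⟩ := hπ
  have hpulls : ∀ i, pulls (π.history y (K * m)) i = m := by
    intro i
    have : ∀ s, (π.history y (K * m) s).1 = sched s := fun s => by
      rw [π.history_arm, hexp s s.2]
    simp only [← hsched i, pulls, this]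
  have hmax := hest _ hpulls
  have hemp : empirical (π.history y (K * m)) =
      fun i => sampleMeasure fun j : Fin m => y (i, j) := by
    funext i
    rw [π.empirical_history, hpulls i]
  rw [hemp] at hmax
  refine ⟨_, hmax, ?_⟩
  exact (commit_invariant hK hmax.1.1.1 (fun t => pulls (π.history y t)) (K * m) hpulls
    (fun t ht i => by
      rw [π.pulls_history_succ, hcom t ht, π.history_castLE]) hT).2

end Policy

section Sampling

variable {K : ℕ} (F : Fin K → Measure ℝ) [∀ i, IsProbabilityMeasure (F i)]

instance isProbabilityMeasure_rewardLaw : IsProbabilityMeasure (rewardLaw F) := by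
  unfold rewardLaw
  infer_instance

theorem map_rewardLaw_sample (i : Fin K) (m : ℕ) :
    (rewardLaw F).map (fun y (j : Fin m) => y (i, (j : ℕ))) = Measure.pi fun _ : Fin m => F i := by
  have hind : iIndepFun (fun (p : Fin K × ℕ) (y : Fin K × ℕ → ℝ) => y p) (rewardLaw F) :=
    iIndepFun_infinitePi (P := fun p : Fin K × ℕ => F p.1) (X := fun _ x => x)
      fun _ => measurable_id
  have hinj : Function.Injective fun j : Fin m => (i, (j : ℕ)) := fun j k h => by
    simpa [Fin.ext_iff] using h
  have := (iIndepFun_iff_map_fun_eq_pi_map (μ := rewardLaw F)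
    (f := fun (j : Fin m) (y : Fin K × ℕ → ℝ) => y (i, (j : ℕ)))
    (fun j => (measurable_pi_apply (i, (j : ℕ))).aemeasurable)).1 (hind.precomp hinj)
  rw [this]
  congr 1
  funext j
  exact Measure.infinitePi_map_eval (fun p : Fin K × ℕ => F p.1) (i, (j : ℕ))

theorem ae_rewardLaw_mem {S : Set ℝ} (hFS : ∀ i, ∀ᵐ x ∂(F i), x ∈ S) :
    ∀ᵐ y ∂(rewardLaw F), ∀ p, y p ∈ S := by
  rw [ae_all_iff]
  intro p
  have h : (rewardLaw F).map (fun y => y p) = F p.1 :=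
    Measure.infinitePi_map_eval (fun p : Fin K × ℕ => F p.1) p
  have h2 := hFS p.1
  rw [← h] at h2
  exact ae_of_ae_map (measurable_pi_apply p).aemeasurable h2

/-- The event that some empirical distribution is not `δ`-close to the law of its arm. -/
def deviationEvent (m : ℕ) (δ : ℝ) : Set (Fin K × ℕ → ℝ) :=
  {y | ∃ i, m * δ ≤ sampleDist (F i) fun j : Fin m => y (i, (j : ℕ))}

theorem measurableSet_deviationEvent (hsub : ∀ i, IsOneSubGaussian (F i))
    (h0 : ∀ i, ∀ᵐ x ∂(F i), 0 ≤ x) (m : ℕ) (δ : ℝ) : MeasurableSet (deviationEvent F m δ) := by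
  have : deviationEvent F m δ =
      ⋃ i, {y | m * δ ≤ sampleDist (F i) fun j : Fin m => y (i, (j : ℕ))} := by
    ext y
    simp [deviationEvent]
  rw [this]
  refine MeasurableSet.iUnion fun i => measurableSet_le measurable_const ?_
  exact (continuous_of_abs_sub_le_sum ((hsub i).abs_sampleDist_sub_le (h0 i))).measurable.comp
    (by fun_prop)

theorem measureReal_deviationEvent_le (hsub : ∀ i, IsOneSubGaussian (F i))
    (h0 : ∀ i, ∀ᵐ x ∂(F i), 0 ≤ x) {m : ℕ} {δ : ℝ} (hδ0 : 0 ≤ δ) (hδ : δ ≤ 6)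
    (hm : 6 ≤ δ * √m) :
    (rewardLaw F).real (deviationEvent F m δ) ≤ K * Real.exp (-(m * δ ^ 2) / 128) := by
  have : deviationEvent F m δ =
      ⋃ i, (fun y (j : Fin m) => y (i, (j : ℕ))) ⁻¹' {x | m * δ ≤ sampleDist (F i) x} := by
    ext y
    simp [deviationEvent]
  rw [this]
  refine (measureReal_iUnion_fintype_le _).trans ?_
  refine (Finset.sum_le_sum (g := fun _ => Real.exp (-(m * δ ^ 2) / 128)) fun i _ => ?_).trans_eq
    (by simp)
  refine ENNReal.toReal_le_of_le_ofReal (Real.exp_pos _).le ?_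
  have hms : MeasurableSet {x : Fin m → ℝ | m * δ ≤ sampleDist (F i) x} :=
    measurableSet_le measurable_const
      (continuous_of_abs_sub_le_sum ((hsub i).abs_sampleDist_sub_le (h0 i))).measurable
  rw [← Measure.map_apply (by fun_prop) hms, map_rewardLaw_sample]
  exact (hsub i).measure_sampleDist_ge_le (h0 i) hδ0 hδ hm

end Sampling

theorem mixture_mem_mixtureClass {K : ℕ} {F : Fin K → Measure ℝ} {S : Set ℝ} {a : Fin K → ℝ}
    (ha : a ∈ stdSimplex ℝ (Fin K)) : mixture a F ∈ mixtureClass S F :=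
  ⟨a, ha, F, fun _ => Or.inl rfl, rfl⟩

section Risk

variable {K : ℕ} {F : Fin K → Measure ℝ} [∀ i, IsProbabilityMeasure (F i)] {S : Set ℝ}
  {h : ℝ → ℝ} {q L : ℝ}

theorem sum_abs_sub_le_two {α β : Fin K → ℝ} (hα : α ∈ stdSimplex ℝ (Fin K))
    (hβ : β ∈ stdSimplex ℝ (Fin K)) : ∑ i, |α i - β i| ≤ 2 := by
  calc ∑ i, |α i - β i| ≤ ∑ i, (α i + β i) := by
        refine Finset.sum_le_sum fun i _ => abs_le.2 ⟨?_, ?_⟩ <;> linarith [hα.1 i, hβ.1 i]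
    _ = 2 := by rw [Finset.sum_add_distrib, hα.2, hβ.2]; norm_num

theorem IsHolderRisk.sub_le_ratio (hH : IsHolderRisk h S F q L) (hq : 0 ≤ q) (hL : 0 ≤ L)
    (hsub : ∀ i, IsOneSubGaussian (F i)) (h0 : ∀ i, ∀ᵐ x ∂(F i), 0 ≤ x) {α β : Fin K → ℝ}
    (hα : α ∈ stdSimplex ℝ (Fin K)) (hβ : β ∈ stdSimplex ℝ (Fin K)) {d : ℝ}
    (hd : ∑ i, |α i - β i| ≤ d) :
    mixtureValue h α F - mixtureValue h β F ≤ L * (wassersteinRatio F * d) ^ q := by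
  refine (hH _ (mixture_mem_mixtureClass hα) _ (mixture_mem_mixtureClass hβ)).trans ?_
  refine mul_le_mul_of_nonneg_left (Real.rpow_le_rpow ENNReal.toReal_nonneg ?_ hq) hL
  refine (wasserstein_mixture_le_ratio hα hβ F (Measure.dirac 0) (by norm_num)
    fun i => (hsub i).cdfDist_dirac_zero_le (h0 i)).trans ?_
  exact mul_le_mul_of_nonneg_left hd (wassersteinRatio_nonneg F)

theorem IsHolderRisk.sub_le (hH : IsHolderRisk h S F q L) (hq : 0 ≤ q) (hL : 0 ≤ L)
    (hsub : ∀ i, IsOneSubGaussian (F i)) (h0 : ∀ i, ∀ᵐ x ∂(F i), 0 ≤ x) {α β : Fin K → ℝ}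
    (hα : α ∈ stdSimplex ℝ (Fin K)) (hβ : β ∈ stdSimplex ℝ (Fin K)) :
    mixtureValue h α F - mixtureValue h β F ≤ L * 6 ^ q := by
  refine (hH _ (mixture_mem_mixtureClass hα) _ (mixture_mem_mixtureClass hβ)).trans ?_
  refine mul_le_mul_of_nonneg_left (Real.rpow_le_rpow ENNReal.toReal_nonneg ?_ hq) hL
  refine (wasserstein_mixture_le_of_weights hα hβ F (Measure.dirac 0) (by norm_num)
    fun i => (hsub i).cdfDist_dirac_zero_le (h0 i)).trans ?_
  linarith [sum_abs_sub_le_two hα hβ]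

/-- If all empirical distributions are `δ`-close to the laws of the arms, then the empirical
maximizer is the true one. -/
theorem IsHolderRisk.argmax_eq (hH : IsHolderRisk h S F q L) (hq : 0 < q) (hL : 0 < L)
    (hsub : ∀ i, IsOneSubGaussian (F i)) (h0 : ∀ i, ∀ᵐ x ∂(F i), 0 ≤ x) {s : Set (Fin K → ℝ)}
    (hs : s ⊆ stdSimplex ℝ (Fin K)) {m : ℕ} (hm : 0 < m) {δ : ℝ} {aStar a : Fin K → ℝ}
    (haStar : aStar ∈ s) (hgap : ∀ b ∈ s, b ≠ aStar →
      2 * (L * δ ^ q) ≤ mixtureValue h aStar F - mixtureValue h b F)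
    {x : Fin K → Fin m → ℝ} (hxS : ∀ i j, x i j ∈ S)
    (hx : ∀ i, sampleDist (F i) (x i) < m * δ)
    (ha : IsArgmax h (fun i => sampleMeasure (x i)) s a) : a = aStar := by
  by_contra hne
  have hmR : (0 : ℝ) < m := by exact_mod_cast hm
  have hprob := fun i => isProbabilityMeasure_sampleMeasure hm (x i)
  have hdist : ∀ i, cdfDist (F i) (sampleMeasure (x i)) =
      ENNReal.ofReal ((m : ℝ)⁻¹ * sampleDist (F i) (x i)) := fun i =>
    (hsub i).cdfDist_sampleMeasure (h0 i) hm (x i)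
  have hnn : ∀ i, 0 ≤ (m : ℝ)⁻¹ * sampleDist (F i) (x i) := fun i =>
    mul_nonneg (by positivity) (integral_nonneg fun _ => abs_nonneg _)
  have hlt : ∀ i, (m : ℝ)⁻¹ * sampleDist (F i) (x i) < δ := fun i => by
    rw [inv_mul_lt_iff₀ hmR]
    exact hx i
  have hmem : ∀ b ∈ s, mixture b (fun i => sampleMeasure (x i)) ∈ mixtureClass S F := fun b hb =>
    ⟨b, hs hb, _, fun i => Or.inr ⟨m, x i, hm, hxS i, rfl⟩, rfl⟩
  have hclose : ∀ b ∈ s, wasserstein (mixture b F) (mixture b fun i => sampleMeasure (x i)) < δ ∧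
      wasserstein (mixture b fun i => sampleMeasure (x i)) (mixture b F) < δ := by
    intro b hb
    have hconv : ∑ i, b i * ((m : ℝ)⁻¹ * sampleDist (F i) (x i)) < δ :=
      (convex_Iio δ).sum_mem (fun i _ => (hs hb).1 i) (hs hb).2 fun i _ => hlt i
    have hdist' : ∀ i, cdfDist (sampleMeasure (x i)) (F i) =
        ENNReal.ofReal ((m : ℝ)⁻¹ * sampleDist (F i) (x i)) := fun i => by
      rw [← hdist i]
      simp only [cdfDist, abs_sub_comm]
    constructor
    · refine (wasserstein_mixture_le (hs hb) F _ fun i => by rw [hdist i]; exact ENNReal.ofReal_ne_top).trans_lt ?_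
      simpa only [hdist, ENNReal.toReal_ofReal (hnn _)] using hconv
    · refine (wasserstein_mixture_le (hs hb) _ F fun i => by rw [hdist' i]; exact ENNReal.ofReal_ne_top).trans_lt ?_
      simpa only [hdist', ENNReal.toReal_ofReal (hnn _)] using hconv
  have hlt' : ∀ w : ℝ, 0 ≤ w → w < δ → L * w ^ q < L * δ ^ q := fun w hw hwδ =>
    mul_lt_mul_of_pos_left (Real.rpow_lt_rpow hw hwδ hq) hL
  have h1 := (hH _ (mixture_mem_mixtureClass (hs haStar)) _ (hmem _ haStar)).trans_lt
    (hlt' _ ENNReal.toReal_nonneg (hclose _ haStar).1)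
  have h2 := (hH _ (hmem _ ha.1) _ (mixture_mem_mixtureClass (hs ha.1))).trans_lt
    (hlt' _ ENNReal.toReal_nonneg (hclose _ ha.1).2)
  have h3 := ha.2 _ haStar
  have h4 := hgap a ha.1 hne
  simp only [mixtureValue] at h3 h4
  linarith

theorem sub_integral_le_of_ae_le {Ω : Type*} [MeasurableSpace Ω] {μ : Measure Ω}
    [IsProbabilityMeasure μ] {v : Ω → ℝ} (hv : Integrable v μ) {B : Set Ω} (hB : MeasurableSet B)
    {V ρ c p : ℝ} (hc : 0 ≤ c) (hp : μ.real B ≤ p)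
    (hle : ∀ᵐ ω ∂μ, V - v ω ≤ ρ + B.indicator (fun _ => c) ω) :
    V - ∫ ω, v ω ∂μ ≤ ρ + c * p := by
  have hi : Integrable (B.indicator fun _ => c) μ := (integrable_const c).indicator hB
  have h1 : ∫ ω, (V - v ω) ∂μ ≤ ∫ ω, (ρ + B.indicator (fun _ => c) ω) ∂μ :=
    integral_mono_ae ((integrable_const V).sub hv) ((integrable_const ρ).add hi) hle
  rw [integral_sub (integrable_const V) hv, integral_add (integrable_const ρ) hi,
    integral_indicator_const _ hB] at h1
  simp only [integral_const, probReal_univ, one_mul, smul_eq_mul] at h1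
  nlinarith

end Risk

section ExplorationLength

theorem explorationLength_top (K : ℕ) {q : ℝ} (hq : 0 < q) (L ε : ℝ) (T : ℕ) :
    explorationLength K q L ε ∞ T = 0 := by
  simp [explorationLength, hq]

theorem explorationLength_zero {K : ℕ} (hK : 0 < K) {q L : ℝ} (hq : 0 < q) (hL : 0 < L) (ε : ℝ)
    (T : ℕ) : explorationLength K q L ε 0 T = ∞ := by
  have hKR : (0 : ℝ) < K := by exact_mod_cast hK
  have hne : ∀ x : ℝ, 0 < x → ENNReal.ofReal x ≠ 0 := fun x hx => (ENNReal.ofReal_pos.2 hx).ne'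
  rw [explorationLength, ENNReal.div_zero (hne _ (by positivity)),
    ENNReal.top_rpow_of_pos (by positivity), ENNReal.mul_top (hne _ (by positivity)),
    ENNReal.top_mul (hne _ (by positivity))]

theorem le_explorationLength {K : ℕ} (hK : 0 < K) {q L ε : ℝ} (hq0 : 0 < q) (hq1 : q ≤ 1)
    (hL : 0 < L) (hε : 0 < ε) {gap : ℝ≥0∞} {T : ℕ}
    (hT : 0 < T) {δ : ℝ} (hδ : 0 < δ) (hδq : 2 * (L * δ ^ q) = gap.toReal) :
    256 * (K : ℝ) ^ 3 * (1024 + Real.log T) ≤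
      (explorationLength K q L ε gap T).toReal * δ ^ 2 := by
  have hKR : (1 : ℝ) ≤ K := by exact_mod_cast hK
  have hTR : (1 : ℝ) ≤ T := by exact_mod_cast hT
  have hδq0 : 0 < δ ^ q := Real.rpow_pos_of_pos hδ q
  have he : 1 ≤ Real.exp 1 := Real.one_le_exp (by norm_num)
  set B : ℝ := 32 / √(Real.exp 1) +
      √(Real.log (2 * K * (T : ℝ) ^ 2 * (ε ^ (-((K : ℝ) - 1)) + 1))) with hB
  have hN : (explorationLength K q L ε gap T).toReal =
      256 * K * Real.exp 1 * (K / δ ^ q) ^ (2 / q) * B ^ 2 := by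
    rw [explorationLength, ENNReal.toReal_mul, ENNReal.toReal_mul, ← ENNReal.toReal_rpow,
      ENNReal.toReal_div, ENNReal.toReal_ofReal (by positivity),
      ENNReal.toReal_ofReal (by positivity), ENNReal.toReal_ofReal (by positivity), ← hδq]
    congr 3
    field_simp
  have hpow : (K : ℝ) ^ 2 ≤ (K / δ ^ q) ^ (2 / q) * δ ^ 2 := by
    rw [Real.div_rpow (by positivity) hδq0.le, ← Real.rpow_mul hδ.le, mul_div_cancel₀ _ hq0.ne',
      Real.rpow_two, div_mul_cancel₀ _ (by positivity), ← Real.rpow_two]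
    refine Real.rpow_le_rpow_of_exponent_le hKR ?_
    rw [le_div_iff₀ hq0]
    linarith
  have hlog : Real.log T ≤
      Real.log (2 * K * (T : ℝ) ^ 2 * (ε ^ (-((K : ℝ) - 1)) + 1)) := by
    refine Real.log_le_log (by linarith) ?_
    have hεp : 0 < ε ^ (-((K : ℝ) - 1)) := Real.rpow_pos_of_pos hε _
    calc (T : ℝ) ≤ (T : ℝ) ^ 2 := by nlinarith
      _ ≤ 2 * K * (T : ℝ) ^ 2 := le_mul_of_one_le_left (by positivity) (by linarith)
      _ ≤ _ := le_mul_of_one_le_right (by positivity) (by linarith)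
  have hlog0 := Real.log_nonneg hTR
  have hB2 : 1024 + Real.log T ≤ Real.exp 1 * B ^ 2 := by
    set ℓ := Real.log (2 * K * (T : ℝ) ^ 2 * (ε ^ (-((K : ℝ) - 1)) + 1))
    have h1 : (32 / √(Real.exp 1)) ^ 2 = 1024 / Real.exp 1 := by
      rw [div_pow, Real.sq_sqrt (Real.exp_pos _).le]
      norm_num
    have h2 : √ℓ ^ 2 = ℓ := Real.sq_sqrt (hlog0.trans hlog)
    have h3 : 1024 / Real.exp 1 + ℓ ≤ B ^ 2 := by
      have : 0 ≤ 32 / √(Real.exp 1) * √ℓ := by positivity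
      rw [hB, add_sq, h1, h2]
      linarith
    calc 1024 + Real.log T ≤ 1024 + Real.exp 1 * ℓ := by nlinarith
      _ = Real.exp 1 * (1024 / Real.exp 1 + ℓ) := by field_simp
      _ ≤ _ := by gcongr
  calc 256 * (K : ℝ) ^ 3 * (1024 + Real.log T)
      = 256 * K * ((K : ℝ) ^ 2 * (1024 + Real.log T)) := by ring
    _ ≤ 256 * K * (((K / δ ^ q) ^ (2 / q) * δ ^ 2) * (Real.exp 1 * B ^ 2)) := by gcongr
    _ = _ := by rw [hN]; ring

end ExplorationLength

section Gap

variable {K : ℕ} {F : Fin K → Measure ℝ} {h : ℝ → ℝ} {ε : ℝ} {aStar : Fin K → ℝ}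

theorem minGap_toReal_le (ha : IsArgmax h F (discreteSimplex K ε) aStar) {a : Fin K → ℝ}
    (haD : a ∈ discreteSimplex K ε) (hne : a ≠ aStar) :
    (minGap h F ε aStar).toReal ≤ mixtureValue h aStar F - mixtureValue h a F :=
  ENNReal.toReal_le_of_le_ofReal (sub_nonneg.2 (ha.2 a haD)) (iInf₂_le a ⟨haD, hne⟩)

theorem eq_of_minGap_eq_top (hgap : minGap h F ε aStar = ∞) {a : Fin K → ℝ}
    (haD : a ∈ discreteSimplex K ε) : a = aStar := by
  by_contra hne
  have : minGap h F ε aStar ≤ _ := iInf₂_le a ⟨haD, hne⟩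
  rw [hgap, top_le_iff] at this
  exact ENNReal.ofReal_ne_top this

theorem exists_ne_of_minGap_ne_top (hgap : minGap h F ε aStar ≠ ∞) :
    ∃ a ∈ discreteSimplex K ε, a ≠ aStar := by
  by_contra! hall
  refine hgap (iInf₂_eq_top.2 fun a ha => absurd (hall a ha.1) ha.2)

theorem single_last_mem_discreteSimplex (hK : 0 < K) (ε : ℝ) :
    Pi.single (⟨K - 1, Nat.sub_lt hK Nat.one_pos⟩ : Fin K) (1 : ℝ) ∈ discreteSimplex K ε := by
  refine ⟨single_mem_stdSimplex ℝ _, fun i hi => ⟨0, ?_⟩⟩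
  rw [Pi.single_eq_of_ne, Nat.cast_zero, mul_zero]
  rintro rfl
  simp only at hi
  omega

theorem two_le_of_stdSimplex_ne {a b : Fin K → ℝ} (ha : a ∈ stdSimplex ℝ (Fin K))
    (hb : b ∈ stdSimplex ℝ (Fin K)) (hne : a ≠ b) : 2 ≤ K := by
  rcases K with _ | _ | K
  · exact absurd (Subsingleton.elim a b) hne
  · refine absurd (funext fun i => ?_) hne
    have h1 := ha.2
    have h2 := hb.2
    rw [Fin.sum_univ_one] at h1 h2
    obtain rfl : i = 0 := Fin.ext (by have := i.2; simp only [Fin.val_zero]; omega)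
    rw [h1, h2]
  · omega

end Gap

section Regret

variable {K : ℕ} {hK : 0 < K} {S : Set ℝ} {F : Fin K → Measure ℝ}
  [∀ i, IsProbabilityMeasure (F i)] {h : ℝ → ℝ} {q L ε : ℝ} {aStar : Fin K → ℝ} {π : Policy K}

theorem IsETCMixture.integral_eq_of_minGap_eq_top {T : ℕ}
    (hπ : IsETCMixture hK h ε T 0 π) (hgap : minGap h F ε aStar = ∞) (hT : 0 < T) :
    ∫ y, mixtureValue h (fun i => (pulls (π.history y T) i : ℝ) / T) F ∂(rewardLaw F) =
      mixtureValue h aStar F := by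
  have hlast := eq_of_minGap_eq_top hgap (single_last_mem_discreteSimplex hK ε)
  have key : ∀ y, (fun i => (pulls (π.history y T) i : ℝ) / T) = aStar := by
    intro y
    obtain ⟨a, ha, hle, -⟩ := hπ.pulls_spec (by simp) y
    rw [eq_of_minGap_eq_top hgap ha.1, ← hlast] at hle
    have hmem := pulls_div_mem_stdSimplex hT (π.history y T)
    have hzero : ∀ i : Fin K, i ≠ ⟨K - 1, Nat.sub_lt hK Nat.one_pos⟩ →
        (pulls (π.history y T) i : ℝ) / T = 0 := by
      intro i hi
      have hi' : (i : ℕ) + 1 < K := by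
        have := i.2
        have : (i : ℕ) ≠ K - 1 := fun h => hi (Fin.ext h)
        omega
      have := hle i hi'
      rw [Pi.single_eq_of_ne hi, mul_zero, Nat.cast_zero, add_zero] at this
      rw [le_antisymm this (Nat.cast_nonneg _), zero_div]
    have hsum := hmem.2
    rw [Finset.sum_eq_single_of_mem _ (Finset.mem_univ _) fun i _ hi => hzero i hi] at hsum
    rw [← hlast]
    funext i
    by_cases hi : i = ⟨K - 1, Nat.sub_lt hK Nat.one_pos⟩
    · rw [hi, Pi.single_eq_same, hsum]
    · rw [Pi.single_eq_of_ne hi, hzero i hi]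
  simp_rw [key]
  simp

/-- On the event that no empirical distribution deviates, the selection frequencies are close to
the optimal discrete mixture. -/
theorem IsETCMixture.sum_abs_sub_le {T m : ℕ} (hπ : IsETCMixture hK h ε T m π)
    (hH : IsHolderRisk h S F q L) (hq : 0 < q) (hL : 0 < L)
    (hsub : ∀ i, IsOneSubGaussian (F i)) (h0 : ∀ i, ∀ᵐ x ∂(F i), 0 ≤ x)
    (ha : IsArgmax h F (discreteSimplex K ε) aStar) {δ : ℝ}
    (hδ : 2 * (L * δ ^ q) = (minGap h F ε aStar).toReal) (hT : 0 < T) (hKm : K ≤ m)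
    (hmT : K * m ≤ T) {y : Fin K × ℕ → ℝ} (hyS : ∀ p, y p ∈ S)
    (hy : y ∉ deviationEvent F m δ) :
    ∑ i, |aStar i - (pulls (π.history y T) i : ℝ) / T| ≤ 2 * (K * m) / T := by
  have hTR : (0 : ℝ) < T := by exact_mod_cast hT
  obtain ⟨a, hmax, h2, h3⟩ := hπ.pulls_spec hmT y
  have hdev : ∀ i, sampleDist (F i) (fun j : Fin m => y (i, (j : ℕ))) < m * δ := by
    simpa [deviationEvent] using hy
  have haa : a = aStar := hH.argmax_eq hq hL hsub h0 (fun b hb => hb.1) (hK.trans_le hKm) ha.1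
    (fun b hb hne => hδ ▸ minGap_toReal_le ha hb hne) (fun i j => hyS _) hdev hmax
  rw [haa] at h2 h3
  have := commit_sum_abs_le ha.1.1 hKm (pulls (π.history y T)) (sum_pulls _) h2 h3
  rw [le_div_iff₀ hTR, Finset.sum_mul]
  refine (Finset.sum_le_sum fun i _ => le_of_eq ?_).trans this
  rw [← abs_of_pos hTR, ← abs_mul, abs_of_pos hTR, sub_mul, div_mul_cancel₀ _ hTR.ne',
    abs_sub_comm, mul_comm]

theorem integrable_mixtureValue_pulls (hH : IsHolderRisk h S F q L) (hq : 0 ≤ q) (hL : 0 ≤ L)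
    (hsub : ∀ i, IsOneSubGaussian (F i)) (h0 : ∀ i, ∀ᵐ x ∂(F i), 0 ≤ x)
    (haS : aStar ∈ stdSimplex ℝ (Fin K)) {T : ℕ} (hT : 0 < T) :
    Integrable (fun y => mixtureValue h (fun i => (pulls (π.history y T) i : ℝ) / T) F)
      (rewardLaw F) := by
  refine Integrable.of_bound (π.measurable_comp_pulls_history T
    fun c => mixtureValue h (fun i => (c i : ℝ) / T) F).aestronglyMeasurable
    (|mixtureValue h aStar F| + L * 6 ^ q) (Filter.Eventually.of_forall fun y => ?_)
  have hmem := pulls_div_mem_stdSimplex hT (π.history y T)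
  have h1 := hH.sub_le hq hL hsub h0 haS hmem
  have h2 := hH.sub_le hq hL hsub h0 hmem haS
  rw [Real.norm_eq_abs, abs_le]
  constructor <;> linarith [neg_abs_le (mixtureValue h aStar F), le_abs_self (mixtureValue h aStar F)]

theorem IsETCMixture.sub_integral_le (hH : IsHolderRisk h S F q L) (hq0 : 0 < q) (hq1 : q ≤ 1)
    (hL : 0 < L) (hFS : ∀ i, ∀ᵐ x ∂(F i), x ∈ S)
    (hsub : ∀ i, IsOneSubGaussian (F i)) (h0 : ∀ i, ∀ᵐ x ∂(F i), 0 ≤ x)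
    (ha : IsArgmax h F (discreteSimplex K ε) aStar) {δ : ℝ} (hδ0 : 0 < δ) (hδ6 : δ ≤ 6)
    (hδ : 2 * (L * δ ^ q) = (minGap h F ε aStar).toReal) {T : ℕ} {n : ℝ} (hn0 : 0 ≤ n)
    (hnT : n < T) (hlen : 256 * (K : ℝ) ^ 3 * (1024 + Real.log T) ≤ n * δ ^ 2)
    (hπ : IsETCMixture hK h ε T ⌈n / K⌉₊ π) :
    mixtureValue h aStar F -
        ∫ y, mixtureValue h (fun i => (pulls (π.history y T) i : ℝ) / T) F ∂(rewardLaw F) ≤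
      2 * (L * (wassersteinRatio F * (3 * n / T)) ^ q) := by
  have hKR : (1 : ℝ) ≤ K := by exact_mod_cast hK
  have hTR : (0 : ℝ) < T := hn0.trans_lt hnT
  have hT : 0 < T := by exact_mod_cast hTR
  have hlog : 0 ≤ Real.log T := Real.log_natCast_nonneg T
  have hW := wassersteinRatio_nonneg F
  set W := wassersteinRatio F
  have hint := integrable_mixtureValue_pulls (π := π) hH hq0.le hL.le hsub h0 ha.1.1 hT
  have hratio := fun y {d : ℝ} => hH.sub_le_ratio hq0.le hL.le hsub h0 ha.1.1
    (pulls_div_mem_stdSimplex hT (π.history y T)) (d := d)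
  have htwo : ∀ y, ∑ i, |aStar i - (pulls (π.history y T) i : ℝ) / T| ≤ 2 := fun y =>
    sum_abs_sub_le_two ha.1.1 (pulls_div_mem_stdSimplex hT _)
  have hρ : 0 ≤ L * (W * (3 * n / T)) ^ q := by positivity
  by_cases hcase : 2 * T ≤ 3 * n
  · have := sub_integral_le_of_ae_le hint MeasurableSet.empty (c := 0) le_rfl (p := 0) (by simp)
      (Filter.Eventually.of_forall fun y => by
        rw [Set.indicator_empty, add_zero]
        exact hratio y ((htwo y).trans ((le_div_iff₀ hTR).2 hcase)))
    linarith
  have hn36 : 256 * (K : ℝ) ^ 3 * 1024 ≤ n * 36 := by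
    have h1 : 256 * (K : ℝ) ^ 3 * 1024 ≤ 256 * (K : ℝ) ^ 3 * (1024 + Real.log T) := by
      gcongr
      linarith
    have h2 : n * δ ^ 2 ≤ n * 36 := by
      gcongr
      nlinarith
    linarith
  have hK3 : (K : ℝ) ≤ (K : ℝ) ^ 2 ∧ (K : ℝ) ^ 2 ≤ (K : ℝ) ^ 3 := by
    constructor <;> nlinarith [sq_nonneg (K : ℝ)]
  set m := ⌈n / K⌉₊ with hm
  have hmge : n / K ≤ m := Nat.le_ceil _
  have hmlt : (m : ℝ) < n / K + 1 := Nat.ceil_lt_add_one (by positivity)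
  have hKm : (K : ℝ) * m ≤ n + K := by
    have : (K : ℝ) * m ≤ K * (n / K + 1) := by gcongr
    rwa [mul_add, mul_div_cancel₀ _ (by positivity), mul_one] at this
  have hnm : n ≤ K * m := by
    rwa [div_le_iff₀ (by positivity), mul_comm] at hmge
  have hKle : K ≤ m := by
    have : (K : ℝ) ≤ n / K := by
      rw [le_div_iff₀ (by positivity)]
      nlinarith
    exact_mod_cast this.trans hmge
  have hmT : K * m ≤ T := by
    have : ((K * m : ℕ) : ℝ) ≤ T := by
      push_cast
      nlinarith
    exact_mod_cast this
  have hmδ : 256 * (1024 + Real.log T) ≤ m * δ ^ 2 := by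
    have h1 : n * δ ^ 2 ≤ K * (m * δ ^ 2) := by nlinarith [sq_nonneg δ]
    have h2 : K * (256 * (1024 + Real.log T)) ≤ 256 * (K : ℝ) ^ 3 * (1024 + Real.log T) := by
      have : (K : ℝ) * (256 * (1024 + Real.log T)) = 256 * K * (1024 + Real.log T) := by ring
      rw [this]
      gcongr
      exact hK3.1.trans hK3.2
    exact le_of_mul_le_mul_left (h2.trans (hlen.trans h1)) (by linarith)
  have hprob : (rewardLaw F).real (deviationEvent F m δ) ≤ n / T := by
    refine (measureReal_deviationEvent_le F hsub h0 hδ0.le hδ6 ?_).trans ?_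
    · refine le_of_sq_le_sq ?_ (by positivity)
      rw [mul_pow, Real.sq_sqrt (Nat.cast_nonneg m)]
      linarith
    · calc K * Real.exp (-(m * δ ^ 2) / 128) ≤ K * Real.exp (-Real.log T) := by
            gcongr
            linarith
        _ = K / T := by rw [Real.exp_neg, Real.exp_log hTR, div_eq_mul_inv]
        _ ≤ n / T := by
            gcongr
            nlinarith
  have hbound := sub_integral_le_of_ae_le hint (measurableSet_deviationEvent F hsub h0 m δ)
    (ρ := L * (W * (3 * n / T)) ^ q) (c := L * (W * 2) ^ q) (V := mixtureValue h aStar F)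
    (by positivity) hprob ((ae_rewardLaw_mem F hFS).mono fun y hyS => by
      by_cases hy : y ∈ deviationEvent F m δ
      · rw [Set.indicator_of_mem hy]
        linarith [hratio y (htwo y)]
      · rw [Set.indicator_of_notMem hy, add_zero]
        refine hratio y ((hπ.sum_abs_sub_le hH hq0 hL hsub h0 ha hδ hT hKle hmT hyS hy).trans ?_)
        refine (div_le_div_iff_of_pos_right hTR).2 ?_
        nlinarith)
  have hlast : L * (W * 2) ^ q * (n / T) ≤ L * (W * (3 * n / T)) ^ q := by
    have h1 : n / T ≤ (n / T) ^ q := by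
      have := Real.rpow_le_rpow_of_exponent_ge' (div_nonneg hn0 hTR.le)
        ((div_le_one hTR).2 hnT.le) hq0.le hq1
      rwa [Real.rpow_one] at this
    calc L * (W * 2) ^ q * (n / T) ≤ L * (W * 2) ^ q * (n / T) ^ q := by gcongr
      _ = L * (W * (2 * n / T)) ^ q := by
          rw [mul_assoc, ← Real.mul_rpow (by positivity) (by positivity)]
          ring_nf
      _ ≤ _ := by gcongr; norm_num
  linarith

end Regret

end RiskBandit

open RiskBandit in
theorem theorem1 {K : ℕ} (hK : 0 < K)
    -- the arms: 1-sub-Gaussian laws on a common set of nonnegative reals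
    (S : Set ℝ) (hS : S ⊆ Set.Ici 0)
    (F : Fin K → Measure ℝ) [∀ i, IsProbabilityMeasure (F i)]
    (hFS : ∀ i, ∀ᵐ x ∂(F i), x ∈ S) (hFsub : ∀ i, IsOneSubGaussian (F i))
    -- the distortion function, with a finite riskmetric at the mixtures of the arms
    (h : ℝ → ℝ) (hmaps : Set.MapsTo h (Set.Icc 0 1) (Set.Icc 0 1)) (h0 : h 0 = 0)
    (hfin : ∀ a ∈ stdSimplex ℝ (Fin K),
      IntegrableOn (fun x => h (1 - cdf (mixture a F) x)) (Set.Ioi 0))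
    (q L : ℝ) (hq0 : 0 < q) (hq1 : q ≤ 1) (hL : 0 < L) (hHolder : IsHolderRisk h S F q L)
    -- the optimal mixture and the optimal discrete mixture
    (ε : ℝ) (hε : 0 < ε)
    (αStar aStar : Fin K → ℝ)
    (hα : IsArgmax h F (stdSimplex ℝ (Fin K)) αStar)
    (ha : IsArgmax h F (discreteSimplex K ε) aStar)
    -- the exploration length, the horizon and the algorithm
    (T : ℕ) (N : ℝ≥0∞) (hN : N = explorationLength K q L ε (minGap h F ε aStar) T)
    (hT : N < (T : ℝ≥0∞))
    (M : ℝ) (hM : M = N.toReal / Real.log T)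
    (W : ℝ) (hW : W = wassersteinRatio F)
    (π : Policy K) (hπ : IsETCMixture hK h ε T ⌈N.toReal / K⌉₊ π) :
    regret h F αStar π T ≤
      (L * K + W ^ (-q)) * (3 * W * M * (Real.log T / T)) ^ q +
        (mixtureValue h αStar F - mixtureValue h aStar F) := by
  have h0 : ∀ i, ∀ᵐ x ∂(F i), 0 ≤ x := fun i => (hFS i).mono fun x hx => hS hx
  have hKR : (0 : ℝ) < K := by exact_mod_cast hK
  have hTpos : 0 < T := by
    rw [← Nat.cast_pos (α := ℝ≥0∞)]
    exact lt_of_le_of_lt zero_le (by simpa using hT)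
  have hWnn : 0 ≤ W := hW ▸ wassersteinRatio_nonneg F
  have hlogT : 0 ≤ Real.log T := Real.log_natCast_nonneg T
  have hMnn : 0 ≤ M := hM ▸ div_nonneg ENNReal.toReal_nonneg hlogT
  have hWq : 0 ≤ W ^ (-q) := Real.rpow_nonneg hWnn _
  have hrhs : 0 ≤ (L * K + W ^ (-q)) * (3 * W * M * (Real.log T / T)) ^ q := by positivity
  rw [regret]
  by_cases hgap : minGap h F ε aStar = ∞
  · have hN0 : N = 0 := by rw [hN, hgap, explorationLength_top K hq0]
    rw [hN0, ENNReal.toReal_zero, zero_div, Nat.ceil_zero] at hπ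
    rw [hπ.integral_eq_of_minGap_eq_top hgap hTpos]
    linarith
  have hgap0 : minGap h F ε aStar ≠ 0 := by
    intro hzero
    rw [hN, hzero, explorationLength_zero hK hq0 hL] at hT
    exact not_top_lt hT
  have hg : 0 < (minGap h F ε aStar).toReal := ENNReal.toReal_pos hgap0 hgap
  obtain ⟨b, hb, hne⟩ := exists_ne_of_minGap_ne_top hgap
  have hK2 : (2 : ℝ) ≤ K := by exact_mod_cast two_le_of_stdSimplex_ne hb.1 ha.1.1 hne
  set g := (minGap h F ε aStar).toReal with hgdef
  set δ := (g / (2 * L)) ^ (1 / q) with hδdef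
  have hδ0 : 0 < δ := by positivity
  have hδq : δ ^ q = g / (2 * L) := by
    rw [hδdef, ← Real.rpow_mul (by positivity), one_div_mul_cancel hq0.ne', Real.rpow_one]
  have hδ : 2 * (L * δ ^ q) = g := by
    rw [hδq]
    field_simp
  have hδ6 : δ ≤ 6 := by
    refine (Real.rpow_le_rpow_iff hδ0.le (by norm_num) hq0).1 ?_
    have h1 := (minGap_toReal_le ha hb hne).trans
      (hHolder.sub_le hq0.le hL.le hFsub h0 ha.1.1 hb.1)
    have h2 : L * δ ^ q ≤ L * 6 ^ q := by
      have : 0 ≤ L * δ ^ q := by positivity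
      linarith
    exact le_of_mul_le_mul_left h2 hL
  have hnT : N.toReal < T := by
    simpa using (ENNReal.toReal_lt_toReal hT.ne_top (ENNReal.natCast_ne_top T)).2 hT
  have hlen := le_explorationLength hK (ε := ε) hq0 hq1 hL hε hTpos hδ0 hδ
  rw [← hN] at hlen
  have hmain := IsETCMixture.sub_integral_le hHolder hq0 hq1 hL hFS hFsub h0 ha hδ0 hδ6 hδ
    ENNReal.toReal_nonneg hnT hlen hπ
  rw [← hW] at hmain
  have hT2 : 1 < (T : ℝ) := by
    have h1 : N.toReal * δ ^ 2 ≤ N.toReal * 36 := by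
      have := ENNReal.toReal_nonneg (a := N)
      gcongr
      nlinarith
    have h2 : (1 : ℝ) ≤ (K : ℝ) ^ 3 := one_le_pow₀ (by linarith)
    nlinarith
  have hlogpos : 0 < Real.log T := Real.log_pos hT2
  have harg : 3 * W * M * (Real.log T / T) = W * (3 * N.toReal / T) := by
    rw [hM]
    field_simp
  rw [harg]
  have hX : 0 ≤ (W * (3 * N.toReal / T)) ^ q := by positivity
  have h1 : 2 * (L * (W * (3 * N.toReal / T)) ^ q) ≤ L * K * (W * (3 * N.toReal / T)) ^ q := by
    have : 0 ≤ L * (W * (3 * N.toReal / T)) ^ q := by positivity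
    nlinarith
  have h2 : 0 ≤ W ^ (-q) * (W * (3 * N.toReal / T)) ^ q := mul_nonneg hWq hX
  linarith
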